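/- Let $\mathbb K$ be a field with $\operatorname{char}\mathbb K\neq 2$ and $\mathbb P^3$ the projective three-space over $\mathbb K$; $\vee$ denotes the span of projective subspaces. **Nets.** A net is a map $f\colon\mathbb Z^2\to\mathbb P^3$, $(i,j)\mapsto f_i^j$. Put $\mathcal O_1f_i^j=f_{i-1}^j\vee f_i^j\vee f_{i+1}^j$ and $\mathcal O_2f_i^j=f_i^{j-1}\vee f_i^j\vee f_i^{j+1}$. The net is *conjugate* if all its elementary quadrilaterals $f_i^j,f_{i+1}^j,f_{i+1}^{j+1},f_i^{j+1}$ are planar, and *regular* if all $\mathcal O_1f_i^j,\mathcal O_2f_i^j$ are planes and no elementary quadrilateral is collinear. The Laplace transforms of a regular conjugate net are $(\mathcal L_1f)_i^j=(f_i^j\vee f_{i+1}^j)\cap(f_i^{j+1}\vee f_{i+1}^{j+1})$ and $(\mathcal L_2f)_i^j=(f_i^j\vee f_i^{j+1})\cap(f_{i+1}^j\vee f_{i+1}^{j+1})$. **Cycles.** A *Laplace cycle of period four* consists of regular conjugate nets $f,h,g,k$ with $h=\mathcal L_1f$, $k=\mathcal L_2f$ and $g_{i+1}^{j+1}=(\mathcal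 L_1h)_i^j=(\mathcal L_2k)_i^j$ for all $i,j$. Its *diagonal congruence* is $A_i^j=f_i^j\vee g_i^j$. The cycle is *in general position* if for all $i,j$ we have $f_i^j\ne g_i^j$, $h_i^j\neq k_i^j$, the two osculating planes $\mathcal O_1,\mathcal O_2$ of each of the four nets at $(i,j)$ are distinct, and $A_i^j$ is skew to $A_{i+1}^j$ and to $A_i^{j+1}$. The diagonal congruence *has skew opposite lines* if $A_i^j\cap A_{i+1}^{j+1}=\varnothing=A_{i+1}^j\cap A_i^{j+1}$ for all $i,j$. **Quadrics.** The regulus of three pairwise skew lines is the set of lines that meet all common transversals of the three lines; the quadric through the three lines is the set of points on the lines of their regulus. **Data.** Points $f_i^0,f_0^i$ and lines $A_i^0,A_0^i$ ($i\in\mathbb Z$, with common values at $(0,0)$) are in *suitable position* if for all $i$: $A_i^0\cap A_{i+1}^0=\varnothing=A_0^i\cap A_0^{i+1}$; $A_i^0\subset f_{i-1}^0\vee f_i^0\vee f_{i+1}^0$ and $A_0^i\subset f_0^{i-1}\vee f_0^i\vee f_0^{i+1}$; $f_i^0\in A_i^0$ and $f_0^i\in A_0^i$. If moreover $A_1^0\cap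 A_0^1=\varnothing$, let $C$ be the intersection of the plane $f_0^0\vee f_1^0\vee f_0^1$ with the quadric through $A_0^0,A_1^0,A_0^1$. **Projection step.** For signs $s,t\in\{1,-1\}$ let $\mathcal Q$ be the quadric through $A_i^j,A_{i+s}^j,A_i^{j+t}$ and $D=\mathcal Q\cap(f_i^j\vee f_{i+s}^j\vee f_i^{j+t})$. The horizontal step produces $f_{i+s}^{j+t}$ as the point other than $f_i^{j+t}$ of $D\cap(f_{i-s}^{j+t}\vee A_i^{j+t})$; the vertical step produces it as the point other than $f_{i+s}^j$ of $D\cap(f_{i+s}^{j-t}\vee A_{i+s}^j)$. In both cases $A_{i+s}^{j+t}$ is the line of the regulus of $A_i^j,A_{i+s}^j,A_i^{j+t}$ through $f_{i+s}^{j+t}$. From data on the axes and a point $x=f_1^1\in C$ (with $A_1^1$ the line through $x$ of the regulus of $A_0^0,A_1^0,A_0^1$), the *construction* obtains first, by vertical steps, all $f_1^j,A_1^j$, and then, by horizontal steps, successively the rows $j=1,2,\dots$ and $j=-1,-2,\dots$. It is *free of singularities* if it yields a point $f_i^j$ and a line $A_i^j$ for all $(i,j)$, the four lines $A$ of every elementary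 quadrilateral are pairwise skew, $f$ is regular with $\mathcal O_1f_i^j\ne\mathcal O_2f_i^j$ for all $i,j$, and $\mathcal L_1f$, $\mathcal L_2f$ are regular. **Theorem.** 1. For every Laplace cycle $f,h,g,k$ of period four in general position with diagonal congruence $A$, the values of $f$ and $A$ on all vertices $(i,0)$ and $(0,i)$ are in suitable position, and if $A_1^0\cap A_0^1=\varnothing$, then $f_1^1\in C$. 2. Such a cycle is uniquely determined by these values and $f_1^1$: if two Laplace cycles of period four in general position have the same $f$ and $A$ on all vertices $(i,0)$, $(0,i)$ and the same $f_1^1$, then all four nets coincide. 3. Given points and lines on the axes in suitable position with $A_1^0\cap A_0^1=\varnothing$, and $x\in C$, a Laplace cycle of period four in general position, whose diagonal congruence has skew opposite lines, with these values of $f$ and $A$ on the axes and with $f_1^1=x$, exists if and only if the construction from these data is free of singularities. 4. In every Laplace cycle of period four in general position whose diagonal congruence has skew opposite lines, the horizontal and the vertical projection step both reproduce $f_{i+s}^{j+t}$ and $A_{i+s}^{j+t}$, for all $i,j\in\mathbb Z$ and $s,t\in\{1,-1\}$; so all routes of projections lead to the same values. -/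

import Mathlib

open scoped LinearAlgebra.Projectivization

noncomputable section

namespace LaplaceCycles

/-! Points of projective three-space are the elements of Mathlib's `ℙ K (Fin 4 → K)`.  Lines,
planes, spans `∨` and intersections `∩` of projective subspaces are taken in the lattice of linear
subspaces of `K⁴`: a line has linear dimension two, a plane has linear dimension three, disjoint
projective subspaces have intersection `⊥`. -/

/-- Projective three-space over `K`. -/
abbrev Pt (K : Type*) [Field K] := ℙ K (Fin 4 → K)

/-- Projective subspaces of three-space, as linear subspaces of `K⁴`. -/
abbrev Sub (K : Type*) [Field K] := Submodule K (Fin 4 → K)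

/-- A discrete net; `f i j` is the vertex with lower index `i` and upper index `j`. -/
abbrev Net (K : Type*) [Field K] := ℤ → ℤ → Pt K

/-- A two-parameter family of projective subspaces (used for line congruences). -/
abbrev Congruence (K : Type*) [Field K] := ℤ → ℤ → Sub K

section Basic

variable {K : Type*} [Field K]

def IsLine (L : Sub K) : Prop := Module.finrank K L = 2

/-- Disjoint projective subspaces. -/
def Skew (L M : Sub K) : Prop := L ⊓ M = ⊥

def Meets (L M : Sub K) : Prop := L ⊓ M ≠ ⊥

/-- The span of two points. -/
def join2 (x y : Pt K) : Sub K := x.submodule ⊔ y.submodule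

/-- The span of three points. -/
def join3 (x y z : Pt K) : Sub K := x.submodule ⊔ y.submodule ⊔ z.submodule

end Basic

section Nets

variable {K : Type*} [Field K]

/-- Osculating plane in the first net direction. -/
def osc1 (f : Net K) (i j : ℤ) : Sub K := join3 (f (i - 1) j) (f i j) (f (i + 1) j)

/-- Osculating plane in the second net direction. -/
def osc2 (f : Net K) (i j : ℤ) : Sub K := join3 (f i (j - 1)) (f i j) (f i (j + 1))

/-- The span of the vertices of an elementary quadrilateral. -/
def face (f : Net K) (i j : ℤ) : Sub K :=
  join2 (f i j) (f (i + 1) j) ⊔ join2 (f i (j + 1)) (f (i + 1) (j + 1))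

/-- All elementary quadrilaterals are planar. -/
def IsConjugate (f : Net K) : Prop := ∀ i j, Module.finrank K (face f i j) ≤ 3

/-- The osculating planes are planes, and no elementary quadrilateral is collinear. -/
structure IsRegular (f : Net K) : Prop where
  osc1_plane : ∀ i j, Module.finrank K (osc1 f i j) = 3
  osc2_plane : ∀ i j, Module.finrank K (osc2 f i j) = 3
  not_collinear : ∀ i j, 2 < Module.finrank K (face f i j)

/-- `h` is the first Laplace transform of `f`. -/
def IsLaplace1 (f h : Net K) : Prop :=
  ∀ i j, (h i j).submodule = join2 (f i j) (f (i + 1) j) ⊓ join2 (f i (j + 1)) (f (i + 1) (j + 1))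

/-- `k` is the second Laplace transform of `f`. -/
def IsLaplace2 (f k : Net K) : Prop :=
  ∀ i j, (k i j).submodule = join2 (f i j) (f i (j + 1)) ⊓ join2 (f (i + 1) j) (f (i + 1) (j + 1))

/-- The nets `f, h, g, k` form a Laplace cycle of period four: all of them are regular conjugate
nets, `h` and `k` are the two Laplace transforms of `f`, and the first Laplace transform of `h`
equals the second Laplace transform of `k`.  The net `g` is this common transform, indexed so
that `g i j` is the vertex opposite to `f i j`, that is, `g i j` lies in the osculating planes
of `f` at `(i, j)`. -/
structure IsLaplaceCycle (f h g k : Net K) : Prop where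
  f_conj : IsConjugate f
  h_conj : IsConjugate h
  g_conj : IsConjugate g
  k_conj : IsConjugate k
  f_reg : IsRegular f
  h_reg : IsRegular h
  g_reg : IsRegular g
  k_reg : IsRegular k
  h_eq : IsLaplace1 f h
  k_eq : IsLaplace2 f k
  g_eq_first : IsLaplace1 h (fun i j => g (i + 1) (j + 1))
  g_eq_second : IsLaplace2 k (fun i j => g (i + 1) (j + 1))

/-- The diagonal congruence: the lines joining corresponding points of opposite nets. -/
def diagonal (f g : Net K) : Congruence K := fun i j => join2 (f i j) (g i j)

/-- Neighbouring lines are skew. -/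
def AdjacentSkew (A : Congruence K) : Prop :=
  ∀ i j, Skew (A i j) (A (i + 1) j) ∧ Skew (A i j) (A i (j + 1))

/-- The two pairs of opposite lines of every elementary quadrilateral are skew. -/
def OppositeSkew (A : Congruence K) : Prop :=
  ∀ i j, Skew (A i j) (A (i + 1) (j + 1)) ∧ Skew (A (i + 1) j) (A i (j + 1))

/-- Corresponding points of opposite nets are distinct, the two osculating planes at every vertex
are distinct, and neighbouring lines of the diagonal congruence through `f` are skew. -/
structure InGeneralPosition (f h g k : Net K) : Prop where
  f_ne_g : ∀ i j, f i j ≠ g i j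
  h_ne_k : ∀ i j, h i j ≠ k i j
  osc_f : ∀ i j, osc1 f i j ≠ osc2 f i j
  osc_h : ∀ i j, osc1 h i j ≠ osc2 h i j
  osc_g : ∀ i j, osc1 g i j ≠ osc2 g i j
  osc_k : ∀ i j, osc1 k i j ≠ osc2 k i j
  skew : AdjacentSkew (diagonal f g)

end Nets

section Quadrics

variable {K : Type*} [Field K]

/-- The regulus of three pairwise skew lines: all lines that meet every common transversal
of the three lines. -/
def regulus (A B C : Sub K) : Set (Sub K) :=
  {L | IsLine L ∧ ∀ T : Sub K, IsLine T → Meets T A → Meets T B → Meets T C → Meets T L}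

/-- The quadric through three pairwise skew lines: all points on the lines of their regulus. -/
def quadric (A B C : Sub K) : Set (Pt K) := {y | ∃ L ∈ regulus A B C, y.submodule ≤ L}

/-- The line of the regulus of `A, B, C` through the point `y` (the join of all such lines; there
is exactly one if `A, B, C` are pairwise skew and `y` is on their quadric). -/
def regulusLine (A B C y : Sub K) : Sub K := sSup {L | L ∈ regulus A B C ∧ y ≤ L}

/-- The projection of the point `x` from the line `Z` onto the conic in which the plane `π` cuts
the quadric through `A, B, Z`; here `z = Z ∩ π`.  It is the point different from `z` in the
intersection of that conic with the plane `x ∨ Z` (the join of all such points). -/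
def conicProjection (A B Z π z x : Sub K) : Sub K :=
  sSup {S | ∃ y : Pt K, y ∈ quadric A B Z ∧ y.submodule ≤ π ∧ y.submodule ≤ x ⊔ Z ∧
    y.submodule ≠ z ∧ S = y.submodule}

end Quadrics

section Construction

variable {K : Type*} [Field K]

/-- A point together with a line. -/
abbrev Flag (K : Type*) [Field K] := Sub K × Sub K

/-- The values of a net and a line congruence on the vertices `(i, 0)` and `(0, i)`. -/
@[ext]
structure AxisData (K : Type*) [Field K] where
  /-- values of the net at `(i, 0)` -/
  fx : ℤ → Pt K
  /-- values of the net at `(0, i)` -/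
  fy : ℤ → Pt K
  /-- values of the congruence at `(i, 0)` -/
  Ax : ℤ → Sub K
  /-- values of the congruence at `(0, i)` -/
  Ay : ℤ → Sub K

/-- The values of `f` and of the diagonal congruence on the axes. -/
def axisData (f g : Net K) : AxisData K where
  fx i := f i 0
  fy i := f 0 i
  Ax i := diagonal f g i 0
  Ay i := diagonal f g 0 i

/-- Points and lines on the axes in suitable position. -/
structure AxisData.IsSuitable (d : AxisData K) : Prop where
  f_origin : d.fx 0 = d.fy 0
  A_origin : d.Ax 0 = d.Ay 0
  line_x : ∀ i, IsLine (d.Ax i)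
  line_y : ∀ i, IsLine (d.Ay i)
  skew_x : ∀ i, Skew (d.Ax i) (d.Ax (i + 1))
  skew_y : ∀ i, Skew (d.Ay i) (d.Ay (i + 1))
  osc_x : ∀ i, d.Ax i ≤ join3 (d.fx (i - 1)) (d.fx i) (d.fx (i + 1))
  osc_y : ∀ i, d.Ay i ≤ join3 (d.fy (i - 1)) (d.fy i) (d.fy (i + 1))
  mem_x : ∀ i, (d.fx i).submodule ≤ d.Ax i
  mem_y : ∀ i, (d.fy i).submodule ≤ d.Ay i

/-- The conic cut out by the plane of the points at `(0,0), (1,0), (0,1)` from the quadric through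
the lines at these vertices. -/
def AxisData.conic (d : AxisData K) : Set (Pt K) :=
  {y | y ∈ quadric (d.Ax 0) (d.Ax 1) (d.Ay 1) ∧ y.submodule ≤ join3 (d.fx 0) (d.fx 1) (d.fy 1)}

/-- The vertex of `f` and the line of the diagonal congruence at `(i, j)`. -/
def cycleFlag (f g : Net K) (i j : ℤ) : Flag K := ((f i j).submodule, diagonal f g i j)

/-- One step of the construction: the fourth vertex of an elementary quadrilateral with known
vertices `a` and its neighbours `b`, `c`.  Its point is the projection of the point `x` from
the line of `c`, its line is the line of the regulus through that point.  (Here `x` is the point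
on the far side of `c`: it belongs to the vertex that together with the wanted one encloses `c`
on a parameter line.) -/
def nextFlag (a b c : Flag K) (x : Sub K) : Flag K :=
  let y := conicProjection a.2 b.2 c.2 (a.1 ⊔ b.1 ⊔ c.1) c.1 x
  (y, regulusLine a.2 b.2 c.2 y)

/-- Given a complete parameter line `rail` and the entries `0` and `1` of a neighbouring parameter
line, construct its entries `0, 1, 2, …` one after the other. -/
def ray (rail : ℤ → Flag K) (s₀ s₁ : Flag K) : ℕ → Flag K
  | 0 => s₀
  | 1 => s₁
  | n + 2 => nextFlag (rail (n + 1)) (rail (n + 2)) (ray rail s₀ s₁ (n + 1)) (ray rail s₀ s₁ n).1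

/-- Given a complete parameter line `rail` and the entries `0` and `1` of a neighbouring parameter
line, construct all entries of that line, in both directions. -/
def extend (rail : ℤ → Flag K) (s₀ s₁ : Flag K) (i : ℤ) : Flag K :=
  if 0 ≤ i then ray rail s₀ s₁ i.toNat
  else ray (fun n => rail (1 - n)) s₁ s₀ (1 - i).toNat

/-- The first coordinate axis. -/
def AxisData.row0 (d : AxisData K) (i : ℤ) : Flag K := ((d.fx i).submodule, d.Ax i)

/-- The second coordinate axis. -/
def AxisData.col0 (d : AxisData K) (j : ℤ) : Flag K := ((d.fy j).submodule, d.Ay j)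

/-- The parameter line of the vertices `(1, j)`, constructed from the axes and the point `x`
at `(1, 1)`. -/
def AxisData.col1 (d : AxisData K) (x : Pt K) : ℤ → Flag K :=
  extend d.col0 (d.row0 1)
    (x.submodule, regulusLine (d.Ax 0) (d.Ax 1) (d.Ay 1) x.submodule)

/-- The parameter lines of the vertices `(i, s * n)`, `s = 1` or `s = -1`, constructed one after
the other for `n = 0, 1, 2, …`. -/
def AxisData.row (d : AxisData K) (x : Pt K) (s : ℤ) : ℕ → ℤ → Flag K
  | 0 => d.row0
  | n + 1 => extend (d.row x s n) (d.col0 (s * (n + 1))) (d.col1 x (s * (n + 1)))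

/-- The point and the line at `(i, j)` constructed by successive projections from the values on
the axes and the point `x` at `(1, 1)`. -/
def AxisData.construct (d : AxisData K) (x : Pt K) (i j : ℤ) : Flag K :=
  d.row x j.sign j.natAbs i

/-- The construction does not run into a singularity: it produces points and lines, the net of
points is regular with distinct osculating planes, its Laplace transforms are regular, and the
four lines of every elementary quadrilateral are pairwise skew. -/
def AxisData.ConstructionRegular (d : AxisData K) (x : Pt K) : Prop :=
  ∃ (f : Net K) (A : Congruence K),
    (∀ i j, d.construct x i j = ((f i j).submodule, A i j)) ∧
    (∀ i j, IsLine (A i j)) ∧ AdjacentSkew A ∧ OppositeSkew A ∧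
    IsRegular f ∧ (∀ i j, osc1 f i j ≠ osc2 f i j) ∧
    (∀ h : Net K, IsLaplace1 f h → IsRegular h) ∧ (∀ k : Net K, IsLaplace2 f k → IsRegular k)

end Construction

end LaplaceCycles

end

/-!
Every elementary quadrilateral of a cycle has a normal form in suitable coordinates of `K⁴`: its
vertices are `F, F - H, F - N, F - H - N` on the net `f` and `G, G - m N, G - l H, G - l H - m N`
on the opposite net `g`, where `H` and `N` are the two Laplace transforms of `f`.  If opposite
lines are skew, then `l ≠ m`, and under `K⁴ = K² ⊗ K²` the four diagonal lines belong to one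
regulus.

The osculating planes of `f` contain the diagonal lines.  Hence three vertices of a quadrilateral
and the next point on one of its parameter lines determine the fourth vertex, and this is what a
projection step computes; induction over the grid shows that a cycle is determined by its values on
the axes and `f 1 1`, and that the construction reproduces it.

Conversely, four pairwise skew lines of a regulus through four coplanar points, no three of which
are collinear, have the normal form.  So a construction without singularities yields frames
`F, G, H, N` of all quadrilaterals.  At each vertex the osculating planes cut out the same point `G`
of the diagonal line for all four adjacent quadrilaterals, and therefore the points `G`, `H`, `N`
fit together to the remaining nets of a cycle.
-/

namespace LaplaceCycles

open Module Submodule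

section LinearAlgebra

variable {K V : Type*} [Field K] [AddCommGroup V] [Module K V] {a b c d : V}

theorem linearIndependent_quad_iff :
    LinearIndependent K ![a, b, c, d] ↔ ∀ x y z w : K,
      x • a + y • b + z • c + w • d = 0 → x = 0 ∧ y = 0 ∧ z = 0 ∧ w = 0 := by
  rw [Fintype.linearIndependent_iff]
  simp only [Fin.sum_univ_four, Fin.forall_fin_succ_pi, Fin.forall_fin_zero_pi, Fin.forall_fin_succ]
  simp

theorem linearIndependent_pair_of_notMem (ha : a ≠ 0) (hb : b ∉ span K {a}) :
    LinearIndependent K ![a, b] :=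
  (LinearIndependent.pair_iff' ha).2 (by simpa only [mem_span_singleton, not_exists] using hb)

theorem finrank_span_pair (h : LinearIndependent K ![a, b]) : finrank K (span K {a, b}) = 2 := by
  rw [← Matrix.range_cons_cons_empty a b ![], finrank_span_eq_card h, Fintype.card_fin]

theorem span_pair_smul_add_smul {s t s' t' : K} (h : s * t' - t * s' ≠ 0) :
    span K {s • a + t • b, s' • a + t' • b} = span K {a, b} := by
  refine le_antisymm ?_ ?_ <;> refine span_le.2 (Set.pair_subset ?_ ?_)
  · exact mem_span_pair.2 ⟨s, t, rfl⟩
  · exact mem_span_pair.2 ⟨s', t', rfl⟩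
  · refine (Submodule.smul_mem_iff _ h).1 (mem_span_pair.2 ⟨t', -t, ?_⟩)
    module
  · refine (Submodule.smul_mem_iff _ h).1 (mem_span_pair.2 ⟨-s', s, ?_⟩)
    module

theorem notMem_of_finrank_le_three (h : LinearIndependent K ![a, b, c, d]) {P : Submodule K V}
    [FiniteDimensional K P] (hP : finrank K P ≤ 3) (ha : a ∈ P) (hb : b ∈ P) (hc : c ∈ P) :
    d ∉ P := by
  intro hd
  have hle : span K (Set.range ![a, b, c, d]) ≤ P := by
    simp [span_le, Set.insert_subset_iff, ha, hb, hc, hd]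
  have := finrank_mono hle
  rw [finrank_span_eq_card h, Fintype.card_fin] at this
  omega

theorem exists_smul_of_span_singleton_eq (h : span K {a} = span K {b}) :
    ∃ r : K, r ≠ 0 ∧ a = r • b := by
  obtain ⟨r, hr⟩ := span_singleton_eq_span_singleton.1 h.symm
  exact ⟨r, r.ne_zero, hr.symm⟩

theorem span_pair_smul_smul {s t : K} (hs : s ≠ 0) (ht : t ≠ 0) :
    span K {s • a, t • b} = span K {a, b} := by
  rw [span_insert, span_insert, span_singleton_smul_eq (.mk0 s hs),
    span_singleton_smul_eq (.mk0 t ht)]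

theorem mem_span_sup_span_sup_span :
    d ∈ span K {a} ⊔ span K {b} ⊔ span K {c} ↔ ∃ x y t : K, x • a + y • b + t • c = d := by
  rw [← span_union, ← span_union, Set.union_assoc]
  exact mem_span_triple

theorem linearIndependent_right_pair (h : LinearIndependent K ![a, b, c, d]) :
    LinearIndependent K ![c, d] :=
  LinearIndependent.pair_iff.2 fun s t e =>
    (linearIndependent_quad_iff.1 h 0 0 s t (by simpa using e)).2.2

theorem linearIndependent_quad_swap (h : LinearIndependent K ![a, b, c, d]) :
    LinearIndependent K ![a, c, b, d] :=
  linearIndependent_quad_iff.2 fun x y z w e => by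
    obtain ⟨h₁, h₂, h₃, h₄⟩ := linearIndependent_quad_iff.1 h x z y w
      (by linear_combination (norm := module) e)
    exact ⟨h₁, h₃, h₂, h₄⟩

theorem linearIndependent_quad_smul {p q r s : K} (h : LinearIndependent K ![a, b, c, d])
    (hp : p ≠ 0) (hq : q ≠ 0) (hr : r ≠ 0) (hs : s ≠ 0) :
    LinearIndependent K ![p • a, q • b, r • c, s • d] :=
  linearIndependent_quad_iff.2 fun x y z w e => by
    simpa [hp, hq, hr, hs] using linearIndependent_quad_iff.1 h (x * p) (y * q) (z * r) (w * s)
      (by linear_combination (norm := module) e)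

theorem linearIndependent_smul_add_smul (h : LinearIndependent K ![a, b, c, d])
    {s t : K} (hst : s ≠ 0 ∨ t ≠ 0) : LinearIndependent K ![s • a + t • b, s • c + t • d] := by
  refine LinearIndependent.pair_iff.2 fun p q e => ?_
  obtain ⟨h₁, h₂, h₃, h₄⟩ := linearIndependent_quad_iff.1 h (p * s) (p * t) (q * s) (q * t)
    (by linear_combination (norm := module) e)
  rcases hst with h0 | h0
  · exact ⟨(mul_eq_zero.1 h₁).resolve_right h0, (mul_eq_zero.1 h₃).resolve_right h0⟩
  · exact ⟨(mul_eq_zero.1 h₂).resolve_right h0, (mul_eq_zero.1 h₄).resolve_right h0⟩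

end LinearAlgebra

section Lines

variable {K : Type*} [Field K] {L M : Sub K} {a b c d : Fin 4 → K}

theorem skew_iff : Skew L M ↔ ∀ v ∈ L, v ∈ M → v = 0 := by
  rw [Skew, ← disjoint_iff, disjoint_def]

theorem Skew.symm (h : Skew L M) : Skew M L := by
  rwa [Skew, inf_comm]

theorem meets_iff : Meets L M ↔ ∃ v ∈ L, v ∈ M ∧ v ≠ 0 := by
  simp only [Meets, Submodule.ne_bot_iff, mem_inf, and_assoc]

theorem isLine_span_pair (h : LinearIndependent K ![a, b]) : IsLine (span K {a, b}) :=
  finrank_span_pair h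

theorem IsLine.eq_of_le (hL : IsLine L) (hM : IsLine M) (h : L ≤ M) : L = M :=
  eq_of_le_of_finrank_eq h (hL.trans hM.symm)

theorem IsLine.eq_span_pair (hL : IsLine L) (h : LinearIndependent K ![a, b]) (ha : a ∈ L)
    (hb : b ∈ L) : L = span K {a, b} :=
  ((isLine_span_pair h).eq_of_le hL (span_le.2 (Set.pair_subset ha hb))).symm

theorem IsLine.exists_eq_span_pair (hL : IsLine L) (ha : a ∈ L) (h0 : a ≠ 0) :
    ∃ b, LinearIndependent K ![a, b] ∧ L = span K {a, b} := by
  obtain ⟨b, hb, hn⟩ : ∃ b ∈ L, b ∉ span K {a} := by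
    by_contra! h
    have h1 := finrank_mono (show L ≤ span K {a} from h)
    rw [finrank_span_singleton h0, hL] at h1
    omega
  have h2 := linearIndependent_pair_of_notMem h0 hn
  exact ⟨b, h2, hL.eq_span_pair h2 ha hb⟩

theorem IsLine.ne_bot (hL : IsLine L) : L ≠ ⊥ := by
  rintro rfl
  simp [IsLine] at hL

theorem IsLine.exists_basis (hL : IsLine L) :
    ∃ a b, LinearIndependent K ![a, b] ∧ L = span K {a, b} := by
  obtain ⟨a, ha, h0⟩ := (Submodule.ne_bot_iff _).1 hL.ne_bot
  exact ⟨a, hL.exists_eq_span_pair ha h0⟩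

theorem Skew.linearIndependent_pair (h : Skew L M) (ha : a ∈ L) (hb : b ∈ M) (ha0 : a ≠ 0)
    (hb0 : b ≠ 0) : LinearIndependent K ![a, b] :=
  linearIndependent_pair_of_notMem ha0 fun hm =>
    hb0 (skew_iff.1 h b ((span_singleton_le_iff_mem a L).2 ha hm) hb)

theorem Skew.linearIndependent_quad (hab : LinearIndependent K ![a, b])
    (hcd : LinearIndependent K ![c, d]) (h : Skew (span K {a, b}) (span K {c, d})) :
    LinearIndependent K ![a, b, c, d] := by
  rw [LinearIndependent.pair_iff] at hab hcd
  refine linearIndependent_quad_iff.2 fun x y z w e => ?_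
  have e' : x • a + y • b = (-z) • c + (-w) • d := by linear_combination (norm := module) e
  have h0 := skew_iff.1 h _ (mem_span_pair.2 ⟨x, y, rfl⟩) (mem_span_pair.2 ⟨-z, -w, e'.symm⟩)
  obtain ⟨hx, hy⟩ := hab _ _ h0
  obtain ⟨hz, hw⟩ := hcd _ _ (e'.symm.trans h0)
  exact ⟨hx, hy, neg_eq_zero.1 hz, neg_eq_zero.1 hw⟩

theorem skew_span_pair (h : LinearIndependent K ![a, b, c, d]) :
    Skew (span K {a, b}) (span K {c, d}) := by
  rw [skew_iff]
  intro v hab hcd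
  obtain ⟨x, y, rfl⟩ := mem_span_pair.1 hab
  obtain ⟨z, w, e⟩ := mem_span_pair.1 hcd
  obtain ⟨rfl, rfl, -, -⟩ := linearIndependent_quad_iff.1 h x y (-z) (-w)
    (by linear_combination (norm := module) -e)
  simp

end Lines

section Regulus

variable {K : Type*} [Field K] {L L' T A B C : Sub K} {u u' v v' w : Fin 4 → K} {s t : K}

/- With `K⁴ = K² ⊗ K²`, the lines `u ∨ u'`, `v ∨ v'`, `(u + v) ∨ (u' + v')` are `e ⊗ K²` for `e`
equal to `(1, 0)`, `(0, 1)`, `(1, 1)`; their common transversals are the lines `K² ⊗ e'`. -/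
theorem exists_eq_span_of_meets (h : LinearIndependent K ![u, u', v, v']) (hT : IsLine T)
    (hu : Meets T (span K {u, u'})) (hv : Meets T (span K {v, v'}))
    (huv : Meets T (span K {u + v, u' + v'})) :
    ∃ s t : K, (s ≠ 0 ∨ t ≠ 0) ∧ T = span K {s • u + t • u', s • v + t • v'} := by
  obtain ⟨x, hxT, hx, hx0⟩ := meets_iff.1 hu
  obtain ⟨y, hyT, hy, hy0⟩ := meets_iff.1 hv
  obtain ⟨z, hzT, hz, hz0⟩ := meets_iff.1 huv
  have hTxy := hT.eq_span_pair ((skew_span_pair h).linearIndependent_pair hx hy hx0 hy0) hxT hyT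
  obtain ⟨p, q, hpq⟩ := mem_span_pair.1 (hTxy ▸ hzT)
  obtain ⟨x₁, x₂, rfl⟩ := mem_span_pair.1 hx
  obtain ⟨y₁, y₂, rfl⟩ := mem_span_pair.1 hy
  obtain ⟨s, t, rfl⟩ := mem_span_pair.1 hz
  obtain ⟨e₁, e₂, e₃, e₄⟩ := linearIndependent_quad_iff.1 h
    (p * x₁ - s) (p * x₂ - t) (q * y₁ - s) (q * y₂ - t) (by linear_combination (norm := module) hpq)
  have hst : s ≠ 0 ∨ t ≠ 0 := by
    by_contra! h0
    simp [h0] at hz0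
  refine ⟨s, t, hst, hT.eq_span_pair (linearIndependent_smul_add_smul h hst) ?_ ?_⟩
  · convert T.smul_mem p hxT using 1
    linear_combination (norm := module) -e₁ • u - e₂ • u'
  · convert T.smul_mem q hyT using 1
    linear_combination (norm := module) -e₃ • v - e₄ • v'

theorem meets_of_smul_add_smul (h : LinearIndependent K ![u, u', v, v']) {p q : K}
    (hpq : p ≠ 0 ∨ q ≠ 0) (hst : s ≠ 0 ∨ t ≠ 0) :
    Meets (span K {p • u + q • u', p • v + q • v'}) (span K {s • u + t • v, s • u' + t • v'}) := by
  rw [meets_iff]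
  refine ⟨s • (p • u + q • u') + t • (p • v + q • v'), mem_span_pair.2 ⟨s, t, rfl⟩,
    mem_span_pair.2 ⟨p, q, by module⟩, fun h0 => ?_⟩
  have hpair := linearIndependent_smul_add_smul h hpq
  obtain ⟨rfl, rfl⟩ := LinearIndependent.pair_iff.1 hpair s t h0
  simp at hst

theorem mem_regulus_iff (h : LinearIndependent K ![u, u', v, v']) :
    L ∈ regulus (span K {u, u'}) (span K {v, v'}) (span K {u + v, u' + v'}) ↔
      ∃ s t : K, (s ≠ 0 ∨ t ≠ 0) ∧ L = span K {s • u + t • v, s • u' + t • v'} := by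
  have hswap := linearIndependent_quad_swap h
  constructor
  · rintro ⟨hL, hmeets⟩
    have key (p q : K) (hpq : p ≠ 0 ∨ q ≠ 0) :
        Meets L (span K {p • u + q • u', p • v + q • v'}) := by
      rw [Meets, inf_comm]
      refine hmeets _ (isLine_span_pair (linearIndependent_smul_add_smul h hpq)) ?_ ?_ ?_
      · simpa using meets_of_smul_add_smul h hpq (s := 1) (t := 0)
      · simpa using meets_of_smul_add_smul h hpq (s := 0) (t := 1)
      · simpa using meets_of_smul_add_smul h hpq (s := 1) (t := 1)
    refine exists_eq_span_of_meets hswap hL ?_ ?_ ?_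
    · simpa using key 1 0
    · simpa using key 0 1
    · simpa using key 1 1
  · rintro ⟨s, t, hst, rfl⟩
    refine ⟨isLine_span_pair (linearIndependent_smul_add_smul hswap hst), fun T hT hu hv huv => ?_⟩
    obtain ⟨p, q, hpq, rfl⟩ := exists_eq_span_of_meets h hT hu hv huv
    exact meets_of_smul_add_smul h hpq hst

theorem eq_of_mem_regulus (h : LinearIndependent K ![u, u', v, v'])
    (hL : L ∈ regulus (span K {u, u'}) (span K {v, v'}) (span K {u + v, u' + v'}))
    (hL' : L' ∈ regulus (span K {u, u'}) (span K {v, v'}) (span K {u + v, u' + v'}))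
    (hw : w ∈ L) (hw' : w ∈ L') (hw0 : w ≠ 0) : L = L' := by
  obtain ⟨s, t, -, rfl⟩ := (mem_regulus_iff h).1 hL
  obtain ⟨s', t', -, rfl⟩ := (mem_regulus_iff h).1 hL'
  obtain ⟨p, q, rfl⟩ := mem_span_pair.1 hw
  obtain ⟨p', q', e⟩ := mem_span_pair.1 hw'
  obtain ⟨e₁, e₂, e₃, e₄⟩ := linearIndependent_quad_iff.1 h (p * s - p' * s') (q * s - q' * s')
    (p * t - p' * t') (q * t - q' * t') (by linear_combination (norm := module) -e)
  have hpq : p ≠ 0 ∨ q ≠ 0 := by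
    by_contra! h0
    simp [h0] at hw0
  obtain ⟨r, hs, ht⟩ : ∃ r : K, s = r * s' ∧ t = r * t' := by
    rcases hpq with h0 | h0
    · exact ⟨p' / p, by field_simp; linear_combination e₁, by field_simp; linear_combination e₃⟩
    · exact ⟨q' / q, by field_simp; linear_combination e₂, by field_simp; linear_combination e₄⟩
  refine hL.1.eq_of_le hL'.1 (span_le.2 (Set.pair_subset ?_ ?_))
  · exact mem_span_pair.2 ⟨r, 0, by rw [hs, ht]; module⟩
  · exact mem_span_pair.2 ⟨0, r, by rw [hs, ht]; module⟩

theorem regulusLine_eq (hL : L ∈ regulus A B C) (hy : T ≤ L)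
    (huniq : ∀ M ∈ regulus A B C, T ≤ M → M = L) : regulusLine A B C T = L :=
  le_antisymm (sSup_le fun M hM => (huniq M hM.1 hM.2).le) (le_sSup ⟨hL, hy⟩)

end Regulus

section Frames

variable {K : Type*} [Field K]

theorem exists_submodule_eq_span_singleton (y : Pt K) :
    ∃ v : Fin 4 → K, v ≠ 0 ∧ y.submodule = span K {v} :=
  ⟨y.rep, y.rep_nonzero, y.submodule_eq⟩

/-- Normal form of an elementary quadrilateral of a Laplace cycle of period four: `a`, `b`, `c`,
`d` are the point of the net `f` and the diagonal line at `(i, j)`, `(i + 1, j)`, `(i, j + 1)`,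
`(i + 1, j + 1)`.  The points of `f` are `F, F - H, F - N, F - H - N`, those of the opposite net
`g` are `G, G - m N, G - l H, G - l H - m N`, and `H`, `N` are the two Laplace transforms of `f` at
`(i, j)`. -/
structure QuadFrame (a b c d : Flag K) (F G H N : Fin 4 → K) (l m : K) : Prop where
  indep : LinearIndependent K ![F, G, H, N]
  l_ne : l ≠ 0
  m_ne : m ≠ 0
  a_pt : a.1 = span K {F}
  b_pt : b.1 = span K {F - H}
  c_pt : c.1 = span K {F - N}
  d_pt : d.1 = span K {F - H - N}
  a_line : a.2 = span K {F, G}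
  b_line : b.2 = span K {F - H, G - m • N}
  c_line : c.2 = span K {F - N, G - l • H}
  d_line : d.2 = span K {F - H - N, G - l • H - m • N}

namespace QuadFrame

variable {a b c d d' e e' : Flag K} {F G H N F' G' H' N' v : Fin 4 → K} {l m l' m' r s t : K}
  {L P x : Sub K}

theorem coeff_eq_zero (h : QuadFrame a b c d F G H N l m) {x y z w : K}
    (e : x • F + y • G + z • H + w • N = 0) : x = 0 ∧ y = 0 ∧ z = 0 ∧ w = 0 :=
  linearIndependent_quad_iff.1 h.indep x y z w e

theorem swap (h : QuadFrame a b c d F G H N l m) : QuadFrame a c b d F G N H m l where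
  indep := linearIndependent_quad_iff.2 fun x y z w e => by
    obtain ⟨h₁, h₂, h₃, h₄⟩ := h.coeff_eq_zero (x := x) (y := y) (z := w) (w := z)
      (by linear_combination (norm := module) e)
    exact ⟨h₁, h₂, h₄, h₃⟩
  l_ne := h.m_ne
  m_ne := h.l_ne
  a_pt := h.a_pt
  b_pt := h.c_pt
  c_pt := h.b_pt
  d_pt := by rw [h.d_pt, sub_right_comm]
  a_line := h.a_line
  b_line := h.c_line
  c_line := h.b_line
  d_line := by rw [h.d_line, sub_right_comm F, sub_right_comm G]

theorem flip_fst (h : QuadFrame a b c d F G H N l m) :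
    QuadFrame b a d c (F - H) (G - m • N) (-H) N (-l) (-m) where
  indep := linearIndependent_quad_iff.2 fun x y z w e => by
    obtain ⟨rfl, rfl, h₃, h₄⟩ := h.coeff_eq_zero (x := x) (y := y) (z := -x - z) (w := w - m * y)
      (by linear_combination (norm := module) e)
    exact ⟨rfl, rfl, by simpa using h₃, by simpa using h₄⟩
  l_ne := neg_ne_zero.2 h.l_ne
  m_ne := neg_ne_zero.2 h.m_ne
  a_pt := h.b_pt
  b_pt := by rw [h.a_pt, sub_neg_eq_add, sub_add_cancel]
  c_pt := h.d_pt
  d_pt := by rw [h.c_pt, sub_neg_eq_add, sub_add_cancel]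
  a_line := h.b_line
  b_line := by
    rw [h.a_line, sub_neg_eq_add, sub_add_cancel, neg_smul, sub_neg_eq_add, sub_add_cancel]
  c_line := by rw [h.d_line, neg_smul_neg, sub_right_comm G]
  d_line := by
    rw [h.c_line, sub_neg_eq_add, sub_add_cancel, neg_smul_neg, neg_smul, sub_neg_eq_add,
      sub_right_comm, sub_add_cancel]

theorem flip_snd (h : QuadFrame a b c d F G H N l m) :
    QuadFrame c d a b (F - N) (G - l • H) H (-N) (-l) (-m) :=
  h.swap.flip_fst.swap

theorem F_ne (h : QuadFrame a b c d F G H N l m) : F ≠ 0 := h.indep.ne_zero 0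

theorem G_ne (h : QuadFrame a b c d F G H N l m) : G ≠ 0 := h.indep.ne_zero 1

theorem H_ne (h : QuadFrame a b c d F G H N l m) : H ≠ 0 := h.indep.ne_zero 2

theorem N_ne (h : QuadFrame a b c d F G H N l m) : N ≠ 0 := h.indep.ne_zero 3

theorem isLine_a (h : QuadFrame a b c d F G H N l m) : IsLine a.2 := by
  have hFG := linearIndependent_smul_add_smul (linearIndependent_quad_swap h.indep)
    (s := 1) (t := 0) (by simp)
  rw [h.a_line]
  exact isLine_span_pair (by simpa using hFG)

theorem isLine_c (h : QuadFrame a b c d F G H N l m) : IsLine c.2 := h.flip_snd.isLine_a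

theorem isLine_d (h : QuadFrame a b c d F G H N l m) : IsLine d.2 := h.flip_fst.isLine_c

theorem mem_line_a (h : QuadFrame a b c d F G H N l m) (s t : K) : s • F + t • G ∈ a.2 := by
  rw [h.a_line]
  exact mem_span_pair.2 ⟨s, t, rfl⟩

theorem skew_ab (h : QuadFrame a b c d F G H N l m) : Skew a.2 b.2 := by
  rw [h.a_line, h.b_line]
  refine skew_span_pair (linearIndependent_quad_iff.2 fun x y z w e => ?_)
  obtain ⟨h₁, h₂, h₃, h₄⟩ := h.coeff_eq_zero (x := x + z) (y := y + w) (z := -z) (w := -(w * m))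
    (by linear_combination (norm := module) e)
  obtain rfl : z = 0 := by simpa using h₃
  obtain rfl : w = 0 := by simpa [h.m_ne] using h₄
  exact ⟨by simpa using h₁, by simpa using h₂, rfl, rfl⟩

theorem skew_ac (h : QuadFrame a b c d F G H N l m) : Skew a.2 c.2 := h.swap.skew_ab

theorem ne_of_skew (h : QuadFrame a b c d F G H N l m) (hs : Skew b.2 c.2) : l ≠ m := by
  rintro rfl
  rw [h.b_line, h.c_line, skew_iff] at hs
  have h₀ := hs (l • (F - H) + (1 : K) • (G - l • N)) (mem_span_pair.2 ⟨_, _, rfl⟩)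
    (mem_span_pair.2 ⟨l, 1, by module⟩)
  have := (h.coeff_eq_zero (x := l) (y := 1) (z := -l) (w := -l)
    (by linear_combination (norm := module) h₀)).2.1
  exact one_ne_zero this

section Regulus

/- The lines `a, b, c` in the normal form of `mem_regulus_iff`. -/
theorem linearIndependent_segre (h : QuadFrame a b c d F G H N l m) (hlm : l ≠ m) :
    LinearIndependent K ![m • F - G, G - l • F, G - m • N, l • (F - H)] := by
  refine linearIndependent_quad_iff.2 fun x y z w e => ?_
  obtain ⟨h₁, h₂, h₃, h₄⟩ := h.coeff_eq_zero (x := m * x - l * y + l * w) (y := -x + y + z)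
    (z := -(l * w)) (w := -(m * z)) (by linear_combination (norm := module) e)
  obtain rfl : w = 0 := by simpa [h.l_ne] using h₃
  obtain rfl : z = 0 := by simpa [h.m_ne] using h₄
  obtain rfl : x = y := by linear_combination -h₂
  have hx : (m - l) * x = 0 := by linear_combination h₁
  obtain rfl : x = 0 := by simpa [sub_eq_zero, hlm.symm] using hx
  exact ⟨rfl, rfl, rfl, rfl⟩

theorem regulus_eq (h : QuadFrame a b c d F G H N l m) (hlm : l ≠ m) :
    regulus a.2 b.2 c.2 = regulus (span K {m • F - G, G - l • F}) (span K {G - m • N, l • (F - H)})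
      (span K {m • F - G + (G - m • N), G - l • F + l • (F - H)}) := by
  have hml : m - l ≠ 0 := sub_ne_zero.2 hlm.symm
  congr
  · rw [h.a_line, ← span_pair_smul_add_smul (s := m) (t := -1) (s' := -l) (t' := 1)
      (by simpa [← sub_eq_add_neg])]
    congr 2 <;> [skip; congr 1] <;> module
  · rw [h.b_line, ← span_pair_smul_add_smul (s := 0) (t := 1) (s' := l) (t' := 0)
      (by simpa using h.l_ne)]
    simp only [zero_smul, zero_add, add_zero, one_smul]
  · rw [h.c_line, ← span_pair_smul_add_smul (s := m) (t := 0) (s' := 0) (t' := 1)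
      (by simpa using h.m_ne)]
    congr 2 <;> [skip; congr 1] <;> module

theorem line_mem_regulus (h : QuadFrame a b c d F G H N l m) (hlm : l ≠ m) :
    d.2 ∈ regulus a.2 b.2 c.2 := by
  rw [h.regulus_eq hlm, mem_regulus_iff (h.linearIndependent_segre hlm)]
  have hdet : m * l * l - -m * -(l * m) ≠ 0 := by
    convert mul_ne_zero (mul_ne_zero h.m_ne h.l_ne) (sub_ne_zero.2 hlm) using 1
    ring
  refine ⟨l, l - m, .inl h.l_ne, ?_⟩
  rw [h.d_line, ← span_pair_smul_add_smul hdet]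
  congr 2 <;> [skip; congr 1] <;> module

theorem d_le (h : QuadFrame a b c d F G H N l m) : d.1 ≤ d.2 := by
  rw [h.d_pt, h.d_line]
  exact span_mono (by simp)

theorem eq_of_mem_regulus (h : QuadFrame a b c d F G H N l m) (hlm : l ≠ m)
    (hL : L ∈ regulus a.2 b.2 c.2) (hd : d.1 ≤ L) : L = d.2 := by
  have hd' := h.line_mem_regulus hlm
  rw [h.regulus_eq hlm] at hL hd'
  have hmem : F - H - N ∈ d.1 := h.d_pt ▸ mem_span_singleton_self _
  exact LaplaceCycles.eq_of_mem_regulus (h.linearIndependent_segre hlm) hL hd' (hd hmem)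
    (h.d_le hmem) h.flip_fst.flip_snd.F_ne

theorem regulusLine_eq (h : QuadFrame a b c d F G H N l m) (hlm : l ≠ m) :
    regulusLine a.2 b.2 c.2 d.1 = d.2 :=
  LaplaceCycles.regulusLine_eq (h.line_mem_regulus hlm) h.d_le
    fun _ hM hle => h.eq_of_mem_regulus hlm hM hle

/- The equation of the quadric on the line joining the points of `c` and `d`, which meets the
quadric in these two points only. -/
theorem mul_add_eq_zero_of_mem_regulus (h : QuadFrame a b c d F G H N l m) (hlm : l ≠ m)
    (hL : L ∈ regulus a.2 b.2 c.2) {p q : K} (hy : p • (F - N) + q • H ∈ L) :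
    q * (p + q) = 0 := by
  rw [h.regulus_eq hlm, mem_regulus_iff (h.linearIndependent_segre hlm)] at hL
  obtain ⟨s, t, -, rfl⟩ := hL
  obtain ⟨α, β, e⟩ := mem_span_pair.1 hy
  obtain ⟨e₁, e₂, e₃, e₄⟩ := h.coeff_eq_zero (x := m * (α * s) - l * (β * s) + l * (β * t) - p)
    (y := -(α * s) + β * s + α * t) (z := -(l * (β * t)) - q) (w := -(m * (α * t)) + p)
    (by linear_combination (norm := module) e)
  obtain rfl : p = m * (α * t) := by linear_combination e₄
  obtain rfl : q = -(l * (β * t)) := by linear_combination -e₃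
  have hq : (m - l) * (β * s) = -(l * (β * t)) := by linear_combination e₁ + m * e₂
  have key : m * (-(l * (β * t)) * (m * (α * t) + -(l * (β * t)))) = 0 := by
    linear_combination l * (m - l) * (β * t) * e₁ - l * (m * (α * t) - l * (β * t)) * hq
  simpa [h.m_ne] using key

end Regulus

theorem d_le_sup (h : QuadFrame a b c d F G H N l m) : d.1 ≤ a.1 ⊔ b.1 ⊔ c.1 := by
  rw [h.a_pt, h.b_pt, h.c_pt, h.d_pt, span_singleton_le_iff_mem, mem_span_sup_span_sup_span]
  exact ⟨-1, 1, 1, by module⟩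

theorem mem_of_line_a_le (h : QuadFrame a b c d F G H N l m) (hP : finrank K P ≤ 3)
    (ha : a.2 ≤ P) (hb : b.1 ≤ P) : F ∈ P ∧ G ∈ P ∧ H ∈ P ∧ N ∉ P := by
  have hF : F ∈ P := ha (by simpa using h.mem_line_a 1 0)
  have hG : G ∈ P := ha (by simpa using h.mem_line_a 0 1)
  have hH : H ∈ P := by
    rw [h.b_pt, span_singleton_le_iff_mem] at hb
    simpa using P.sub_mem hF hb
  exact ⟨hF, hG, hH, notMem_of_finrank_le_three h.indep hP hF hG hH⟩

theorem mem_of_line_c_le (h : QuadFrame a b c d F G H N l m) (hP : finrank K P ≤ 3)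
    (hc : c.2 ≤ P) (hd : d.1 ≤ P) : F - N ∈ P ∧ G ∈ P ∧ H ∈ P ∧ N ∉ P := by
  obtain ⟨hFN, hGH, hH, hN⟩ := h.flip_snd.mem_of_line_a_le hP hc hd
  exact ⟨hFN, by simpa using P.add_mem hGH (P.smul_mem l hH), hH, by simpa using hN⟩

theorem eq_c_or_eq_d (h : QuadFrame a b c d F G H N l m) (hlm : l ≠ m) (hP : finrank K P ≤ 3)
    (hc : c.2 ≤ P) (hd : d.1 ≤ P) (hL : L ∈ regulus a.2 b.2 c.2) (hvL : v ∈ L)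
    (hv : v ∈ a.1 ⊔ b.1 ⊔ c.1) (hvP : v ∈ P) (hv0 : v ≠ 0) :
    span K {v} = c.1 ∨ span K {v} = d.1 := by
  rw [h.a_pt, h.b_pt, h.c_pt, mem_span_sup_span_sup_span] at hv
  obtain ⟨p, q, r, rfl⟩ := hv
  obtain ⟨hFN, -, hH, hN⟩ := h.mem_of_line_c_le hP hc hd
  have hpqN : (p + q) • N ∈ P := by
    convert P.sub_mem hvP (P.sub_mem (P.smul_mem (p + q + r) hFN) (P.smul_mem q hH)) using 1
    module
  have hpq : p + q = 0 := by
    by_contra h₀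
    exact hN ((P.smul_mem_iff h₀).1 hpqN)
  obtain rfl : p = -q := by linear_combination hpq
  have hqr := h.mul_add_eq_zero_of_mem_regulus hlm hL (p := r) (q := -q)
    (by convert hvL using 1; module)
  rcases mul_eq_zero.1 hqr with hq | hq
  · obtain rfl : q = 0 := by simpa using hq
    left
    rw [h.c_pt, show -(0 : K) • F + (0 : K) • (F - H) + r • (F - N) = r • (F - N) by module]
    refine span_singleton_smul_eq (.mk0 r ?_) _
    rintro rfl
    simp at hv0
  · obtain rfl : r = q := by linear_combination hq
    right
    rw [h.d_pt, show -r • F + r • (F - H) + r • (F - N) = r • (F - H - N) by module]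
    refine span_singleton_smul_eq (.mk0 r ?_) _
    rintro rfl
    simp at hv0

theorem conicProjection_eq (h : QuadFrame a b c d F G H N l m) (hlm : l ≠ m)
    (hx : finrank K (x ⊔ c.2 : Sub K) ≤ 3) (hd : d.1 ≤ x ⊔ c.2) :
    conicProjection a.2 b.2 c.2 (a.1 ⊔ b.1 ⊔ c.1) c.1 x = d.1 := by
  apply le_antisymm
  · refine sSup_le ?_
    rintro _ ⟨y, ⟨L, hL, hyL⟩, hπ, hP, hne, rfl⟩
    obtain ⟨v, hv0, hv⟩ := exists_submodule_eq_span_singleton y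
    rw [hv] at hyL hπ hP hne ⊢
    rw [span_singleton_le_iff_mem] at hyL hπ hP
    exact ((h.eq_c_or_eq_d hlm hx le_sup_right hd hL hyL hπ hP hv0).resolve_left hne).le
  · have hy : (Projectivization.mk K (F - H - N) h.flip_fst.flip_snd.F_ne).submodule = d.1 := by
      rw [Projectivization.submodule_mk, h.d_pt]
    refine le_sSup ⟨_, ⟨d.2, h.line_mem_regulus hlm, hy.trans_le h.d_le⟩, hy.trans_le h.d_le_sup,
      hy.trans_le hd, fun e => ?_, hy.symm⟩
    rw [hy, h.d_pt, h.c_pt] at e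
    obtain ⟨r, -, hr⟩ := exists_smul_of_span_singleton_eq e
    have := (h.coeff_eq_zero (x := 1 - r) (y := 0) (z := -1) (w := r - 1)
      (by linear_combination (norm := module) hr)).2.2.1
    simp at this

theorem nextFlag_eq (h : QuadFrame a b c d F G H N l m) (hlm : l ≠ m)
    (hx : finrank K (x ⊔ c.2 : Sub K) ≤ 3) (hd : d.1 ≤ x ⊔ c.2) : nextFlag a b c x = d := by
  simp only [nextFlag, h.conicProjection_eq hlm hx hd, h.regulusLine_eq hlm]

section Uniqueness

theorem exists_smul_eq (h : QuadFrame a b c d F G H N l m)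
    (h' : QuadFrame a b c d' F' G' H' N' l' m') : ∃ r s t : K, r ≠ 0 ∧ F' = r • F ∧
      F' - H' = s • (F - H) ∧ F' - N' = t • (F - N) := by
  obtain ⟨r, hr, hF⟩ := exists_smul_of_span_singleton_eq (h'.a_pt.symm.trans h.a_pt)
  obtain ⟨s, -, hH⟩ := exists_smul_of_span_singleton_eq (h'.b_pt.symm.trans h.b_pt)
  obtain ⟨t, -, hN⟩ := exists_smul_of_span_singleton_eq (h'.c_pt.symm.trans h.c_pt)
  exact ⟨r, s, t, hr, hF, hH, hN⟩

/- Compares coefficients in `G' - m' N' ∈ b` for `G' = x F + y G`. -/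
theorem coeff_G (h : QuadFrame a b c d F G H N l m) (h' : QuadFrame a b c d' F' G' H' N' l' m')
    (hF : F' = r • F) (hN : F' - N' = t • (F - N)) {x y : K} (hG : x • F + y • G = G') :
    x = m' * (r - t) ∧ m' * t = y * m := by
  have hb : G' - m' • N' ∈ b.2 := h'.b_line ▸ subset_span (by simp)
  rw [h.b_line] at hb
  obtain ⟨p, q, e⟩ := mem_span_pair.1 hb
  obtain rfl : N' = r • F - t • (F - N) := by rw [← hN, ← hF]; abel
  obtain ⟨e₁, e₂, e₃, e₄⟩ := h.coeff_eq_zero (x := p - x + m' * (r - t)) (y := q - y) (z := -p)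
    (w := m' * t - q * m) (by linear_combination (norm := module) e - hG)
  exact ⟨by linear_combination -e₁ - e₃, by linear_combination e₄ + m * e₂⟩

/- The common ratio of `F', H'` to `F, H` propagates to `N` and to `G`, which are determined by the
lines `b` and `c`. -/
theorem eq_of_smul (h : QuadFrame a b c d F G H N l m) (h' : QuadFrame a b c d' F' G' H' N' l' m')
    (hr : r ≠ 0) (hF : F' = r • F) (hH : F' - H' = r • (F - H)) (hN : F' - N' = t • (F - N)) :
    d = d' := by
  have hG : G' ∈ a.2 := by
    rw [h'.a_line]
    exact subset_span (by simp)
  rw [h.a_line] at hG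
  obtain ⟨x, y, hG⟩ := mem_span_pair.1 hG
  obtain ⟨hx, hl⟩ := h.swap.coeff_G h'.swap hF hH hG
  obtain ⟨hx', hm⟩ := h.coeff_G h' hF hN hG
  obtain rfl : x = 0 := by simpa using hx
  obtain rfl : r = t := by simpa [h'.m_ne, sub_eq_zero] using hx'
  have hy : y ≠ 0 := by
    rintro rfl
    exact h'.G_ne (by simp [← hG])
  have hD : F' - H' - N' = r • (F - H - N) := by linear_combination (norm := module) hH + hN - hF
  have hGD : G' - l' • H' - m' • N' = y • (G - l • H - m • N) := by
    obtain rfl : H' = r • H := by linear_combination (norm := module) hF - hH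
    obtain rfl : N' = r • N := by linear_combination (norm := module) hF - hN
    rw [← hG, smul_smul, smul_smul, hl, hm]
    module
  refine Prod.ext ?_ (h.isLine_d.eq_of_le h'.isLine_d ?_)
  · rw [h.d_pt, h'.d_pt, hD, span_singleton_smul_eq (.mk0 r hr)]
  · rw [h.d_line, h'.d_line, hD, hGD, span_le]
    refine Set.pair_subset (mem_span_pair.2 ⟨r⁻¹, 0, ?_⟩) (mem_span_pair.2 ⟨0, y⁻¹, ?_⟩)
    · rw [inv_smul_smul₀ hr, zero_smul, add_zero]
    · rw [inv_smul_smul₀ hy, zero_smul, zero_add]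

/- In `K⁴ / P`, in which `F = N ≠ 0` and `H = 0`, the point of `d'` becomes `s • F - r • F`. -/
theorem eq_of_plane (h : QuadFrame a b c d F G H N l m)
    (h' : QuadFrame a b c d' F' G' H' N' l' m') (hP : finrank K P ≤ 3)
    (hc : c.2 ≤ P) (hd : d.1 ≤ P) (hd' : d'.1 ≤ P) : d = d' := by
  obtain ⟨r, s, t, hr, hF, hH, hN⟩ := h.exists_smul_eq h'
  obtain ⟨hFN, -, hHP, hNP⟩ := h.mem_of_line_c_le hP hc hd
  rw [h'.d_pt, span_singleton_le_iff_mem] at hd'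
  have hmem : (s - r) • N ∈ P := by
    convert P.sub_mem hd' (P.sub_mem (P.smul_mem (s + t - r) hFN) (P.smul_mem s hHP)) using 1
    linear_combination (norm := module) hF - hH - hN
  obtain rfl : s = r := by
    by_contra h₀
    exact hNP ((P.smul_mem_iff (sub_ne_zero.2 h₀)).1 hmem)
  exact h.eq_of_smul h' hr hF hH hN

theorem eq_of_point (h : QuadFrame a b c d F G H N l m)
    (h' : QuadFrame a b c d' F' G' H' N' l' m') (hd : d.1 = d'.1) : d = d' := by
  obtain ⟨r, s, t, hr, hF, hH, hN⟩ := h.exists_smul_eq h'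
  obtain ⟨u, -, hD⟩ := exists_smul_of_span_singleton_eq (h'.d_pt.symm.trans (hd.symm.trans h.d_pt))
  obtain ⟨e₁, -, -, e₄⟩ := h.coeff_eq_zero (x := u - s - t + r) (y := 0) (z := s - u) (w := t - u)
    (by linear_combination (norm := module) hH + hN - hF - hD)
  obtain rfl : s = r := by linear_combination -e₁ - e₄
  exact h.eq_of_smul h' hr hF hH hN

end Uniqueness

section Neighbours

theorem line_a_inf_eq (h : QuadFrame a b c d F G H N l m) (hP : finrank K P ≤ 3)
    (hc : c.2 ≤ P) (hd : d.1 ≤ P) : a.2 ⊓ P = span K {G} := by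
  obtain ⟨hFN, hG, -, hN⟩ := h.mem_of_line_c_le hP hc hd
  refine le_antisymm (fun z hz => ?_) ?_
  · obtain ⟨hza, hzP⟩ := mem_inf.1 hz
    rw [h.a_line] at hza
    obtain ⟨s, t, rfl⟩ := mem_span_pair.1 hza
    have hsN : s • N ∈ P := by
      convert P.sub_mem hzP (P.add_mem (P.smul_mem s hFN) (P.smul_mem t hG)) using 1
      module
    obtain rfl : s = 0 := by
      by_contra h₀
      exact hN ((P.smul_mem_iff h₀).1 hsN)
    exact mem_span_singleton.2 ⟨t, by module⟩
  · rw [span_singleton_le_iff_mem]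
    exact ⟨by simpa using h.mem_line_a 0 1, hG⟩

theorem mem_span_G_N (h : QuadFrame a b c d F G H N l m)
    (h' : QuadFrame a b e e' F' G' H' N' l' m') (hG : span K {G'} = span K {G})
    (ha : a.2 ≤ e.1 ⊔ a.1 ⊔ c.1) : ∃ β γ : K, G = β • N' + γ • N := by
  obtain ⟨q, -, hG⟩ := exists_smul_of_span_singleton_eq hG
  obtain ⟨r, -, hF⟩ := exists_smul_of_span_singleton_eq (h'.a_pt.symm.trans h.a_pt)
  have hGm : G ∈ e.1 ⊔ a.1 ⊔ c.1 := ha (by simpa using h.mem_line_a 0 1)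
  rw [h'.c_pt, h.a_pt, h.c_pt, mem_span_sup_span_sup_span] at hGm
  obtain ⟨x, y, z, e₁⟩ := hGm
  have hb : G' - m' • N' ∈ b.2 := h'.b_line ▸ subset_span (by simp)
  rw [h.b_line] at hb
  obtain ⟨u, v, e₂⟩ := mem_span_pair.1 hb
  obtain ⟨k₁, -, k₃, -⟩ := h.coeff_eq_zero (x := x * u + m' * (x * r + y + z))
    (y := x * v - x * q - m') (z := -(x * u)) (w := -(x * v * m) - m' * z)
    (by linear_combination (norm := module) x • e₂ + x • hG + m' • e₁ - (m' * x) • hF)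
  have h₀ : x * r + y + z = 0 := by
    have : m' * (x * r + y + z) = 0 := by linear_combination k₁ + k₃
    simpa [h'.m_ne] using this
  exact ⟨-x, -z, by linear_combination (norm := module) -e₁ + x • hF + h₀ • F⟩

/- The plane `e' ∨ b ∨ d` contains `F' - H' - N'`, `F - H` and `N`, hence also `N'`. -/
theorem line_b_le (h : QuadFrame a b c d F G H N l m)
    (h' : QuadFrame a b e e' F' G' H' N' l' m') (hG : span K {G'} = span K {G})
    (ha : a.2 ≤ e.1 ⊔ a.1 ⊔ c.1) : b.2 ≤ e'.1 ⊔ b.1 ⊔ d.1 := by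
  obtain ⟨β, γ, hβγ⟩ := h.mem_span_G_N h' hG ha
  obtain ⟨s, -, hH⟩ := exists_smul_of_span_singleton_eq (h'.b_pt.symm.trans h.b_pt)
  rw [h.b_line, span_le]
  refine Set.pair_subset ?_ ?_
  · rw [h.b_pt]
    exact mem_sup_left (mem_sup_right (mem_span_singleton_self _))
  · rw [h'.d_pt, h.b_pt, h.d_pt, SetLike.mem_coe, mem_span_sup_span_sup_span]
    exact ⟨-β, β * s + (γ - m), -(γ - m),
      by linear_combination (norm := module) -hβγ - β • hH⟩

end Neighbours

end QuadFrame
end Frames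

section Points

variable {K : Type*} [Field K] {x y z : Pt K} {A L M P Q : Sub K}

theorem join2_comm (x y : Pt K) : join2 x y = join2 y x := sup_comm _ _

theorem finrank_join2_le (x y : Pt K) : finrank K (join2 x y) ≤ 2 := by
  have := finrank_add_le_finrank_add_finrank x.submodule y.submodule
  rwa [x.finrank_submodule, y.finrank_submodule] at this

theorem isLine_join2 (h : x ≠ y) : IsLine (join2 x y) := by
  rw [join2, x.submodule_eq, y.submodule_eq, ← span_insert]
  exact isLine_span_pair (Projectivization.linearIndependent_pair_iff_ne.2 h)

theorem Pt.eq_of_le (h : x.submodule ≤ y.submodule) : x = y :=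
  Projectivization.submodule_injective
    (eq_of_le_of_finrank_eq h (x.finrank_submodule.trans y.finrank_submodule.symm))

theorem Pt.not_le_of_skew (h : Skew L M) (hx : x.submodule ≤ L) : ¬ x.submodule ≤ M := fun hy => by
  rw [x.submodule_eq, span_singleton_le_iff_mem] at hx hy
  exact x.rep_nonzero (skew_iff.1 h _ hx hy)

theorem Pt.ne_of_skew (h : Skew L M) (hx : x.submodule ≤ L) (hy : y.submodule ≤ M) : x ≠ y := by
  rintro rfl
  exact Pt.not_le_of_skew h hx hy

theorem Pt.exchange (h : x.submodule ≤ join2 y z) (hne : x ≠ y) :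
    z.submodule ≤ join2 y x := by
  have heq : join2 y x = join2 y z :=
    eq_of_le_of_finrank_le (sup_le le_sup_left h)
      ((finrank_join2_le y z).trans_eq (isLine_join2 hne.symm).symm)
  exact heq ▸ le_sup_right

theorem plane_eq_of_line_le_of_point_le (hA : IsLine A) (hx : ¬ x.submodule ≤ A)
    (hP : finrank K P ≤ 3) (hQ : finrank K Q ≤ 3) (hAP : A ≤ P) (hAQ : A ≤ Q)
    (hxP : x.submodule ≤ P) (hxQ : x.submodule ≤ Q) : P = Q := by
  have hlt : finrank K A < finrank K (x.submodule ⊔ A : Sub K) :=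
    finrank_lt_finrank_of_lt (right_lt_sup.2 hx)
  have hxA : 3 ≤ finrank K (x.submodule ⊔ A : Sub K) := by
    rwa [hA] at hlt
  have hspan {R : Sub K} (hR : finrank K R ≤ 3) (h : A ≤ R) (h' : x.submodule ≤ R) :
      x.submodule ⊔ A = R := eq_of_le_of_finrank_le (sup_le h' h) (hR.trans hxA)
  exact (hspan hP hAP hxP).symm.trans (hspan hQ hAQ hxQ)

end Points

section Graphs

variable {K : Type*} [Field K] {A B C D : Sub K} {a b : Fin 4 → K} {q : K}
  {φ : (Fin 4 → K) →ₗ[K] (Fin 4 → K)}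

theorem Skew.exists_linearMap (hB : IsLine B) (hC : IsLine C) (h : Skew B C) :
    ∃ φ : (Fin 4 → K) →ₗ[K] (Fin 4 → K), ∀ v, φ v ∈ B ∧ v + φ v ∈ C := by
  have hcompl : IsCompl B C := by
    refine ⟨disjoint_iff.2 h, codisjoint_iff.2 (eq_top_of_disjoint B C ?_ (disjoint_iff.2 h))⟩
    rw [hB, hC, finrank_fin_fun]
  refine ⟨-B.projection C hcompl, fun v => ⟨B.neg_mem (projection_apply_mem hcompl v), ?_⟩⟩
  exact sub_eq_add_neg v _ ▸ sub_projection_mem hcompl v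

theorem linearIndependent_quad_of_map (hAB : Skew A B) (hAC : Skew A C)
    (hφ : ∀ v ∈ A, φ v ∈ B ∧ v + φ v ∈ C) (hab : LinearIndependent K ![a, b]) (ha : a ∈ A)
    (hb : b ∈ A) : LinearIndependent K ![a, b, φ a, φ b] := by
  have hA : span K {a, b} ≤ A := span_le.2 (Set.pair_subset ha hb)
  have hB : span K {φ a, φ b} ≤ B := span_le.2 (Set.pair_subset (hφ a ha).1 (hφ b hb).1)
  refine Skew.linearIndependent_quad hab (LinearIndependent.pair_iff.2 fun s t h0 => ?_)
    (skew_iff.2 fun v hv hv' => skew_iff.1 hAB v (hA hv) (hB hv'))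
  have hv : s • a + t • b ∈ A := hA (mem_span_pair.2 ⟨s, t, rfl⟩)
  have hvC := (hφ _ hv).2
  rw [map_add, map_smul, map_smul, h0, add_zero] at hvC
  exact LinearIndependent.pair_iff.1 hab s t (skew_iff.1 hAC _ hv hvC)

theorem Skew.exists_map_eq (hA : IsLine A) (hB : IsLine B) (hC : IsLine C) (hAB : Skew A B)
    (hAC : Skew A C) (hBC : Skew B C) :
    ∃ φ : (Fin 4 → K) →ₗ[K] (Fin 4 → K), A.map φ = B ∧ A.map (1 + φ) = C := by
  obtain ⟨φ, hφ⟩ := hBC.exists_linearMap hB hC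
  obtain ⟨u, u', huu', rfl⟩ := hA.exists_basis
  have hI := linearIndependent_quad_of_map hAB hAC (fun v _ => hφ v) huu'
    (subset_span (by simp)) (subset_span (by simp))
  have hlin {s t : K} (hst : s ≠ 0 ∨ t ≠ 0) :=
    linearIndependent_smul_add_smul (linearIndependent_quad_swap hI) hst
  simp only [map_span, Set.image_pair]
  refine ⟨φ, (hB.eq_span_pair ?_ (hφ u).1 (hφ u').1).symm,
    (hC.eq_span_pair ?_ (hφ u).2 (hφ u').2).symm⟩
  · simpa using hlin (s := 0) (t := 1) (by simp)
  · simpa using hlin (s := 1) (t := 1) (by simp)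

theorem linearIndependent_pair_of_not_collinear (hAB : Skew A B) (hAC : Skew A C)
    (hφ : ∀ v ∈ A, φ v ∈ B ∧ v + φ v ∈ C) (hb : b ∈ A) (hb0 : b ≠ 0)
    (hne : ∀ L : Sub K, IsLine L →
      ¬ span K {b - a} ⊔ span K {q • φ b - φ a} ⊔ span K {a + φ a} ≤ L) :
    LinearIndependent K ![a, b] := by
  by_contra hab
  obtain ⟨r, rfl⟩ : ∃ r : K, r • b = a := by
    simpa [LinearIndependent.pair_symm_iff (x := a), LinearIndependent.pair_iff' hb0] using hab
  have hφ0 : φ b ≠ 0 := fun hφ0 =>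
    hb0 (skew_iff.1 hAC _ hb (by simpa [hφ0] using (hφ b hb).2))
  refine hne (span K {b, φ b})
    (isLine_span_pair (hAB.linearIndependent_pair hb (hφ b hb).1 hb0 hφ0)) ?_
  simp only [sup_le_iff, span_singleton_le_iff_mem, mem_span_pair, map_smul]
  exact ⟨⟨⟨1 - r, 0, by module⟩, 0, q - r, by module⟩, r, r, rfl⟩

/-- Four lines no two of which meet, the position in which the construction has to put the lines at
the vertices of an elementary quadrilateral. -/
structure PairwiseSkewLines (A B C D : Sub K) : Prop where
  line_a : IsLine A
  line_b : IsLine B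
  line_c : IsLine C
  line_d : IsLine D
  skew_ab : Skew A B
  skew_ac : Skew A C
  skew_ad : Skew A D
  skew_bc : Skew B C
  skew_bd : Skew B D
  skew_cd : Skew C D

namespace PairwiseSkewLines

/- If `C` is the graph of the isomorphism `φ` from `A` to `B`, then the lines of the regulus that
are skew to `A, B, C` are the graphs of `q • φ` with `q ≠ 0, 1`. -/
theorem exists_map_eq (h : PairwiseSkewLines A B C D) (hD : D ∈ regulus A B C) :
    ∃ (φ : (Fin 4 → K) →ₗ[K] (Fin 4 → K)) (q : K), q ≠ 0 ∧ q ≠ 1 ∧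
      A.map φ = B ∧ A.map (1 + φ) = C ∧ A.map (1 + q • φ) = D := by
  obtain ⟨φ, hB, hC⟩ := Skew.exists_map_eq h.line_a h.line_b h.line_c h.skew_ab h.skew_ac h.skew_bc
  have hφ (v) (hv : v ∈ A) : φ v ∈ B ∧ v + φ v ∈ C :=
    ⟨hB ▸ mem_map_of_mem hv, hC ▸ mem_map_of_mem hv⟩
  obtain ⟨u, u', huu', hA⟩ := h.line_a.exists_basis
  have hu : u ∈ A := hA ▸ subset_span (by simp)
  have hI := linearIndependent_quad_of_map h.skew_ab h.skew_ac hφ huu' hu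
    (hA ▸ subset_span (by simp))
  have hB' : B = span K {φ u, φ u'} := by rw [← hB, hA, map_span, Set.image_pair]
  have hC' : C = span K {u + φ u, u' + φ u'} := by
    rw [← hC, hA, map_span, Set.image_pair]
    rfl
  rw [hA, hB', hC', mem_regulus_iff hI] at hD
  obtain ⟨s, t, hst, hD⟩ := hD
  have hmem : s • u + t • φ u ∈ D := hD ▸ subset_span (by simp)
  have hs : s ≠ 0 := by
    rintro rfl
    rw [zero_smul, zero_add, D.smul_mem_iff (by simpa using hst)] at hmem
    exact hI.ne_zero 2 (skew_iff.1 h.skew_bd _ (hφ u hu).1 hmem)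
  refine ⟨φ, s⁻¹ * t, ?_, ?_, hB, hC, ?_⟩
  · intro h0
    obtain rfl : t = 0 := by simpa [hs] using h0
    rw [zero_smul, add_zero, D.smul_mem_iff hs] at hmem
    exact hI.ne_zero 0 (skew_iff.1 h.skew_ad _ hu hmem)
  · intro h1
    obtain rfl : s = t := by rw [inv_mul_eq_one₀ hs] at h1; exact h1
    rw [← smul_add, D.smul_mem_iff hs] at hmem
    have h0 := skew_iff.1 h.skew_cd _ (hφ u hu).2 hmem
    exact one_ne_zero (linearIndependent_quad_iff.1 hI 1 0 1 0 (by simpa using h0)).1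
  · rw [hA, hD, map_span, Set.image_pair, ← span_pair_smul_add_smul (s := s) (t := 0) (s' := 0)
      (t' := s) (by simpa using hs)]
    simp [smul_smul, hs]

end PairwiseSkewLines

end Graphs

section Converse

variable {K : Type*} [Field K] {A B C D x y z S : Sub K} {a b c d : Flag K} {pa pb pc pd : Pt K}
  {u u' v v' w : Fin 4 → K} {q : K}

theorem QuadFrame.of_segre (h : LinearIndependent K ![u, u', v, v']) (hq0 : q ≠ 0) (hq1 : q ≠ 1)
    (ha : a.1 = span K {u - u'}) (hb : b.1 = span K {q • v' - v}) (hc : c.1 = span K {u + v})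
    (hd : d.1 = span K {u' + q • v'}) (hA : a.2 = span K {u, u'}) (hB : b.2 = span K {v, v'})
    (hC : c.2 = span K {u + v, u' + v'}) (hD : d.2 = span K {u + q • v, u' + q • v'}) :
    QuadFrame a b c d (u - u') (-(1 - q) • u') (u - u' + v - q • v') (-u' - v) 1 (1 - q) := by
  have hq : 1 - q ≠ 0 := sub_ne_zero.2 hq1.symm
  refine ⟨?_, one_ne_zero, hq, ha, ?_, ?_, ?_, ?_, ?_, ?_, ?_⟩
  · refine linearIndependent_quad_iff.2 fun x₁ x₂ x₃ x₄ e => ?_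
    obtain ⟨k₁, k₂, k₃, k₄⟩ := linearIndependent_quad_iff.1 h (x₁ + x₃)
      (-x₁ - x₂ * (1 - q) - x₃ - x₄) (x₃ - x₄) (-x₃ * q) (by linear_combination (norm := module) e)
    obtain rfl : x₃ = 0 := by simpa [hq0] using k₄
    obtain rfl : x₁ = 0 := by simpa using k₁
    obtain rfl : x₄ = 0 := by simpa using k₃
    exact ⟨rfl, by simpa [hq] using k₂, rfl, rfl⟩
  · rw [hb]
    congr 2; module
  · rw [hc]
    congr 2; module
  · rw [hd]
    congr 2; module
  · rw [hA, ← span_pair_smul_add_smul (s := 1) (t := -1) (s' := 0) (t' := q - 1)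
      (by simpa [sub_eq_zero] using hq1)]
    congr 2 <;> [skip; congr 1] <;> module
  · rw [hB, ← span_pair_smul_add_smul (s := -1) (t := q) (s' := 1 - q) (t' := 0)
      (by simpa using ⟨hq0, hq⟩)]
    congr 2 <;> [skip; congr 1] <;> module
  · rw [hC, ← span_pair_smul_add_smul (s := 1) (t := 0) (s' := -1) (t' := q) (by simpa using hq0)]
    congr 2 <;> [skip; congr 1] <;> module
  · rw [hD, ← span_pair_smul_add_smul (s := 0) (t := 1) (s' := -1) (t' := 1) (by simp)]
    congr 2 <;> [skip; congr 1] <;> module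

namespace PairwiseSkewLines

/- Write the point on `C` as `a + φ a` and the point on `D` as `a' + q • φ a'`.  Their difference
decomposes uniquely into vectors of `A` and `B`, hence `u = a' - a` and `v = q • φ a' - φ a`. -/
theorem exists_quadFrame_of_add (h : PairwiseSkewLines A B C D) (hD : D ∈ regulus A B C)
    (ha : u ∈ A) (hb : v ∈ B) (hc : w ∈ C) (hd : u + v + w ∈ D) (h0 : u + v + w ≠ 0)
    (hne : ∀ L : Sub K, IsLine L → ¬ span K {u} ⊔ span K {v} ⊔ span K {w} ≤ L) :
    ∃ F G H N l m, QuadFrame (span K {u}, A) (span K {v}, B) (span K {w}, C)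
      (span K {u + v + w}, D) F G H N l m := by
  obtain ⟨φ, q, hq0, hq1, hB, hC, hD⟩ := h.exists_map_eq hD
  obtain ⟨a, haA, rfl⟩ := (hC ▸ hc : w ∈ A.map (1 + φ))
  obtain ⟨a', ha'A, hd'⟩ := (hD ▸ hd : _ ∈ A.map (1 + q • φ))
  have hφ {z} (hz : z ∈ A) : φ z ∈ B := hB ▸ mem_map_of_mem hz
  replace hd' : a' + q • φ a' = u + v + (a + φ a) := hd'
  have hAB : u + a - a' = q • φ a' - φ a - v := by linear_combination (norm := module) -hd'
  have hu : u + a - a' = 0 := skew_iff.1 h.skew_ab _ (A.sub_mem (A.add_mem ha haA) ha'A)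
    (hAB ▸ B.sub_mem (B.sub_mem (B.smul_mem q (hφ ha'A)) (hφ haA)) hb)
  obtain rfl : u = a' - a := by linear_combination (norm := module) hu
  obtain rfl : v = q • φ a' - φ a := by linear_combination (norm := module) hAB
  rw [LinearMap.add_apply, Module.End.one_apply] at *
  rw [← hd'] at h0 ⊢
  have hφ' (z) (hz : z ∈ A) : φ z ∈ B ∧ z + φ z ∈ C := ⟨hφ hz, hC ▸ mem_map_of_mem hz⟩
  have ha'0 : a' ≠ 0 := by
    rintro rfl
    simp at h0
  have haa' := linearIndependent_pair_of_not_collinear h.skew_ab h.skew_ac hφ' ha'A ha'0 hne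
  have hI := linearIndependent_quad_of_map h.skew_ab h.skew_ac hφ' haa' haA ha'A
  have hA := h.line_a.eq_span_pair haa' haA ha'A
  refine ⟨_, _, _, _, _, _, QuadFrame.of_segre hI hq0 hq1 ?_ rfl rfl rfl hA ?_ ?_ ?_⟩
  · rw [← neg_sub, ← Set.neg_singleton, span_neg]
  · rw [← hB, hA, map_span, Set.image_pair]
  · rw [← hC, hA, map_span, Set.image_pair]; rfl
  · rw [← hD, hA, map_span, Set.image_pair]; rfl

theorem exists_quadFrame (h : PairwiseSkewLines A B C D) (hD : D ∈ regulus A B C)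
    (ha : pa.submodule ≤ A) (hb : pb.submodule ≤ B) (hc : pc.submodule ≤ C)
    (hd : pd.submodule ≤ D) (hπ : pd.submodule ≤ join3 pa pb pc)
    (hbc : ¬ pd.submodule ≤ join2 pb pc) (hac : ¬ pd.submodule ≤ join2 pa pc)
    (hab : ¬ pd.submodule ≤ join2 pa pb)
    (hne : ∀ L : Sub K, IsLine L → ¬ join2 pa pb ⊔ join2 pc pd ≤ L) :
    ∃ F G H N l m, QuadFrame (pa.submodule, A) (pb.submodule, B) (pc.submodule, C)
      (pd.submodule, D) F G H N l m := by
  obtain ⟨u, -, hu⟩ := exists_submodule_eq_span_singleton pa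
  obtain ⟨v, -, hv⟩ := exists_submodule_eq_span_singleton pb
  obtain ⟨w, -, hw⟩ := exists_submodule_eq_span_singleton pc
  obtain ⟨z, hz0, hz⟩ := exists_submodule_eq_span_singleton pd
  have hspan : join2 pa pb ⊔ join2 pc pd = join3 pa pb pc :=
    le_antisymm (sup_le le_sup_left (sup_le le_sup_right hπ))
      (sup_le_sup_left le_sup_left _)
  rw [hspan] at hne
  clear hspan
  simp only [join2, join3, hu, hv, hw, hz, span_singleton_le_iff_mem] at *
  obtain ⟨α, β, γ, rfl⟩ := mem_span_sup_span_sup_span.1 hπ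
  have hα : α ≠ 0 := by
    rintro rfl
    exact hbc (mem_sup.2 ⟨_, mem_span_singleton.2 ⟨β, rfl⟩, _, mem_span_singleton.2 ⟨γ, rfl⟩,
      by module⟩)
  have hβ : β ≠ 0 := by
    rintro rfl
    exact hac (mem_sup.2 ⟨_, mem_span_singleton.2 ⟨α, rfl⟩, _, mem_span_singleton.2 ⟨γ, rfl⟩,
      by module⟩)
  have hγ : γ ≠ 0 := by
    rintro rfl
    exact hab (mem_sup.2 ⟨_, mem_span_singleton.2 ⟨α, rfl⟩, _, mem_span_singleton.2 ⟨β, rfl⟩,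
      by module⟩)
  have hscale {r : K} (hr : r ≠ 0) (x : Fin 4 → K) : span K {r • x} = span K {x} :=
    span_singleton_smul_eq (.mk0 r hr) x
  rw [← hscale hα u, ← hscale hβ v, ← hscale hγ w] at hne ⊢
  exact h.exists_quadFrame_of_add hD (A.smul_mem α ha) (B.smul_mem β hb) (C.smul_mem γ hc) hd hz0
    hne

theorem left_le_sup_of_le_join2 (h : PairwiseSkewLines A B C D) (hD : D ∈ regulus A B C)
    (ha : pa.submodule ≤ A) (hb : pb.submodule ≤ B) (hd : pd.submodule ≤ D)
    (hab : pd.submodule ≤ join2 pa pb) : pa.submodule ≤ pd.submodule ⊔ C := by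
  obtain ⟨φ, q, -, hq1, hB, hC, hD⟩ := h.exists_map_eq hD
  obtain ⟨u, -, hu⟩ := exists_submodule_eq_span_singleton pa
  obtain ⟨v, -, hv⟩ := exists_submodule_eq_span_singleton pb
  obtain ⟨w, hw0, hw⟩ := exists_submodule_eq_span_singleton pd
  simp only [join2, hu, hv, hw, span_singleton_le_iff_mem] at ha hb hd hab ⊢
  obtain ⟨a, ha', rfl⟩ := (hD ▸ hd : w ∈ A.map (1 + q • φ))
  obtain ⟨x, y, e⟩ := mem_span_pair.1 ((span_insert (R := K) u {v}).symm ▸ hab)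
  have hφ : φ a ∈ B := hB ▸ mem_map_of_mem ha'
  replace e : x • u + y • v = a + q • φ a := e
  have hAB : x • u - a = q • φ a - y • v := by linear_combination (norm := module) e
  have hxu : x • u - a = 0 := skew_iff.1 h.skew_ab _ (A.sub_mem (A.smul_mem x ha) ha')
    (hAB ▸ B.sub_mem (B.smul_mem q hφ) (B.smul_mem y hb))
  obtain rfl : x • u = a := sub_eq_zero.1 hxu
  have hx : x ≠ 0 := by
    rintro rfl
    simp at hw0
  refine (smul_mem_iff _ (mul_ne_zero hx (sub_ne_zero.2 hq1.symm))).1 (mem_sup.2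
    ⟨_, mem_span_singleton_self _, _, C.smul_mem (-q) (hC ▸ mem_map_of_mem ha'), ?_⟩)
  simp only [LinearMap.add_apply, LinearMap.smul_apply, Module.End.one_apply]
  module

end PairwiseSkewLines

theorem left_mem_regulus (hA : IsLine A) : A ∈ regulus A B C := ⟨hA, fun _ _ h _ _ => h⟩

theorem middle_mem_regulus (hB : IsLine B) : B ∈ regulus A B C := ⟨hB, fun _ _ _ h _ => h⟩

theorem regulusLine_spec (hD : IsLine D) (h : regulusLine A B C y = D) :
    D ∈ regulus A B C ∧ y ≤ D := by
  obtain ⟨L, hL, hyL⟩ : {L | L ∈ regulus A B C ∧ y ≤ L}.Nonempty := by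
    rw [Set.nonempty_iff_ne_empty]
    intro h0
    rw [regulusLine, h0, sSup_empty] at h
    exact hD.ne_bot h.symm
  obtain rfl : L = D := hL.1.eq_of_le hD (h ▸ le_sSup ⟨hL, hyL⟩)
  exact ⟨hL, hyL⟩

theorem eq_of_conicProjection (h : conicProjection A B C S z x = pd.submodule)
    (hA : pa ∈ quadric A B C) (hS : pa.submodule ≤ S) (hx : pa.submodule ≤ x ⊔ C)
    (hz : pa.submodule ≠ z) : pa = pd :=
  Pt.eq_of_le (h ▸ le_sSup ⟨pa, hA, hS, hx, hz, rfl⟩)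

theorem conicProjection_spec (h : conicProjection A B C S z x = pd.submodule) :
    pd.submodule ≤ S ∧ pd.submodule ≤ x ⊔ C := by
  obtain ⟨_, p, hp, hS, hx, hz, -⟩ : {T | ∃ y : Pt K, y ∈ quadric A B C ∧ y.submodule ≤ S ∧
      y.submodule ≤ x ⊔ C ∧ y.submodule ≠ z ∧ T = y.submodule}.Nonempty := by
    rw [Set.nonempty_iff_ne_empty]
    intro h0
    have hpd := pd.finrank_submodule
    rw [← h, conicProjection, h0, sSup_empty, finrank_bot] at hpd
    exact zero_ne_one hpd
  obtain rfl := eq_of_conicProjection h hp hS hx hz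
  exact ⟨hS, hx⟩

theorem nextFlag_spec (hD : IsLine D)
    (h : nextFlag (pa.submodule, A) (pb.submodule, B) (pc.submodule, C) x = (pd.submodule, D)) :
    D ∈ regulus A B C ∧ pd.submodule ≤ D ∧ pd.submodule ≤ join3 pa pb pc ∧
      pd.submodule ≤ x ⊔ C := by
  obtain ⟨hp, hL⟩ := Prod.ext_iff.1 h
  obtain ⟨hreg, hd⟩ := regulusLine_spec hD hL
  obtain ⟨hπ, hx⟩ := conicProjection_spec hp
  exact ⟨hreg, hp.ge.trans hd, hπ, hx⟩

theorem PairwiseSkewLines.exists_quadFrame_of_nextFlag (h : PairwiseSkewLines A B C D)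
    (ha : pa.submodule ≤ A) (hb : pb.submodule ≤ B) (hc : pc.submodule ≤ C)
    (hnext : nextFlag (pa.submodule, A) (pb.submodule, B) (pc.submodule, C) x = (pd.submodule, D))
    (hne : ∀ L : Sub K, IsLine L → ¬ join2 pa pb ⊔ join2 pc pd ≤ L) :
    ∃ F G H N l m, QuadFrame (pa.submodule, A) (pb.submodule, B) (pc.submodule, C)
      (pd.submodule, D) F G H N l m := by
  obtain ⟨hreg, hd, hπ, hx⟩ := nextFlag_spec h.line_d hnext
  have hproj := (Prod.ext_iff.1 hnext).1
  have hcx : pc.submodule ≤ x ⊔ C := hc.trans le_sup_right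
  have hdc : pd ≠ pc := Pt.ne_of_skew h.skew_cd.symm hd hc
  have ha_not : ¬ pa.submodule ≤ x ⊔ C := fun hax =>
    Pt.ne_of_skew h.skew_ad ha hd (eq_of_conicProjection hproj ⟨A, left_mem_regulus h.line_a, ha⟩
      (le_sup_left.trans le_sup_left) hax
      (Projectivization.submodule_injective.ne (Pt.ne_of_skew h.skew_ac ha hc)))
  have hb_not : ¬ pb.submodule ≤ x ⊔ C := fun hbx =>
    Pt.ne_of_skew h.skew_bd hb hd (eq_of_conicProjection hproj ⟨B, middle_mem_regulus h.line_b, hb⟩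
      (le_sup_right.trans le_sup_left) hbx
      (Projectivization.submodule_injective.ne (Pt.ne_of_skew h.skew_bc hb hc)))
  refine h.exists_quadFrame hreg ha hb hc hd hπ (fun hbc => hb_not ?_) (fun hac => ha_not ?_)
    (fun hab => ha_not ?_) hne
  · exact (Pt.exchange (join2_comm pb pc ▸ hbc) hdc).trans (sup_le hcx hx)
  · exact (Pt.exchange (join2_comm pa pc ▸ hac) hdc).trans (sup_le hcx hx)
  · exact (h.left_le_sup_of_le_join2 hreg ha hb hd hab).trans (sup_le hx le_sup_right)

end Converse

section Grid

/-- The unit step `s` from `i` leads away from the interval from `0` to `m`.  Once a family is known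
on this interval, such steps reach all other integers one after the other. -/
def Outward (m i s : ℤ) : Prop := m ≤ i ∧ s = 1 ∨ i ≤ 0 ∧ s = -1

theorem Outward.eq_one_or_eq_neg_one {m i s : ℤ} (h : Outward m i s) : s = 1 ∨ s = -1 :=
  h.imp And.right And.right

theorem Outward.exists_eq_mul_natCast {j t : ℤ} (h : Outward 0 j t) : ∃ n : ℕ, j = t * n := by
  rcases h with ⟨hj, rfl⟩ | ⟨hj, rfl⟩
  · exact ⟨j.toNat, by omega⟩
  · exact ⟨(-j).toNat, by omega⟩

theorem exists_outward_one (i : ℤ) : ∃ s, Outward 1 i s := by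
  rcases le_or_gt 1 i with hi | hi
  · exact ⟨1, .inl ⟨hi, rfl⟩⟩
  · exact ⟨-1, .inr ⟨Int.lt_add_one_iff.1 hi, rfl⟩⟩

theorem exists_outward_zero_add_eq {j : ℤ} (hj : j ≠ 0) : ∃ i s, Outward 0 i s ∧ i + s = j := by
  rcases lt_or_gt_of_ne hj with hj | hj
  · exact ⟨j + 1, -1, .inr ⟨hj, rfl⟩, add_neg_cancel_right j 1⟩
  · exact ⟨j - 1, 1, .inl ⟨Int.le_sub_one_of_lt hj, rfl⟩, sub_add_cancel j 1⟩

theorem exists_outward_edge {m i : ℤ} (hi : i < 0 ∨ m ≤ i) :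
    ∃ i' s, Outward m i' s ∧ (i' = i ∧ i' + s = i + 1 ∨ i' = i + 1 ∧ i' + s = i) := by
  rcases hi with hi | hi
  · exact ⟨i + 1, -1, .inr ⟨hi, rfl⟩, .inr ⟨rfl, add_neg_cancel_right i 1⟩⟩
  · exact ⟨i, 1, .inl ⟨hi, rfl⟩, .inl ⟨rfl, rfl⟩⟩

theorem outward_induction_of_zero {Q : ℤ → Prop} (h0 : Q 0)
    (hs : ∀ j t, Outward 0 j t → Q j → Q (j + t)) (j : ℤ) : Q j := by
  induction j with
  | zero => exact h0
  | succ n ih => exact hs n 1 (.inl ⟨n.cast_nonneg, rfl⟩) ih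
  | pred n ih => exact hs (-n) (-1) (.inr ⟨by omega, rfl⟩) ih

theorem outward_induction_of_zero_one {Q : ℤ → Prop} (h0 : Q 0) (h1 : Q 1)
    (hs : ∀ i s, Outward 1 i s → Q i → Q (i - s) → Q (i + s)) (i : ℤ) : Q i := by
  have up (n : ℕ) : Q n := by
    induction n using Nat.twoStepInduction with
    | zero => exact h0
    | one => exact h1
    | more n ih ih' =>
      have hn := hs (n + 1) 1 (.inl ⟨by omega, rfl⟩) (mod_cast ih') (by simpa using ih)
      exact_mod_cast hn
  have down (n : ℕ) : Q (1 - n) := by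
    induction n using Nat.twoStepInduction with
    | zero => exact h1
    | one => exact h0
    | more n ih ih' =>
      have hn := hs (1 - (n + 1 : ℕ)) (-1) (.inr ⟨by omega, rfl⟩) ih'
        (by convert ih using 1; omega)
      convert hn using 1
      omega
  rcases le_total 0 i with hi | hi
  · exact Int.toNat_of_nonneg hi ▸ up i.toNat
  · convert down (1 - i).toNat using 1
    omega

theorem grid_induction {P : ℤ → ℤ → Prop} (hx : ∀ i, P i 0) (hy : ∀ j, P 0 j) (h11 : P 1 1)
    (col : ∀ j t, Outward 1 j t → P 0 j → P 0 (j + t) → P 1 j → P 1 (j - t) → P 1 (j + t))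
    (row : ∀ i j s t, Outward 1 i s → Outward 0 j t →
      P i j → P (i + s) j → P i (j + t) → P (i - s) (j + t) → P (i + s) (j + t))
    (i j : ℤ) : P i j := by
  have h1 : ∀ j, P 1 j := outward_induction_of_zero_one (hx 1) h11
    fun j t ht h1 h2 => col j t ht (hy _) (hy _) h1 h2
  have hrow : ∀ j i, P i j := outward_induction_of_zero hx fun j t ht ih =>
    outward_induction_of_zero_one (hy _) (h1 _)
      fun i s hs h1 h2 => row i j s t hs ht (ih _) (ih _) h1 h2
  exact hrow j i

variable {K : Type*} [Field K]

section Extend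

variable (rail : ℤ → Flag K) (s₀ s₁ : Flag K)

theorem extend_natCast (n : ℕ) : extend rail s₀ s₁ n = ray rail s₀ s₁ n := by
  simp [extend]

theorem extend_one_sub_natCast (n : ℕ) :
    extend rail s₀ s₁ (1 - n) = ray (fun n => rail (1 - n)) s₁ s₀ n := by
  rcases n with _ | _ | n
  · simp [extend, ray]
  · simp [extend, ray]
  · rw [extend, if_neg (by push_cast; omega)]
    congr
    omega

theorem extend_zero : extend rail s₀ s₁ 0 = s₀ := extend_natCast rail s₀ s₁ 0

theorem extend_one : extend rail s₀ s₁ 1 = s₁ := extend_natCast rail s₀ s₁ 1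

theorem extend_step {i s : ℤ} (h : Outward 1 i s) :
    extend rail s₀ s₁ (i + s) = nextFlag (rail i) (rail (i + s)) (extend rail s₀ s₁ i)
      (extend rail s₀ s₁ (i - s)).1 := by
  rcases h with ⟨hi, rfl⟩ | ⟨hi, rfl⟩
  · obtain ⟨n, rfl⟩ : ∃ n : ℕ, i = n + 1 := ⟨(i - 1).toNat, by omega⟩
    rw [add_sub_cancel_right]
    exact_mod_cast extend_natCast rail s₀ s₁ (n + 2)
  · obtain ⟨n, rfl⟩ : ∃ n : ℕ, i = 1 - (n + 1 : ℕ) := ⟨(-i).toNat, by omega⟩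
    have hnext : 1 - ((n + 1 : ℕ) : ℤ) + -1 = 1 - (n + 2 : ℕ) := by omega
    have hprev : 1 - ((n + 1 : ℕ) : ℤ) - -1 = 1 - (n : ℕ) := by omega
    rw [hnext, hprev]
    simp only [extend_one_sub_natCast]
    exact rfl

end Extend

variable (d : AxisData K) (x : Pt K)

theorem construct_zero_right (i : ℤ) : d.construct x i 0 = d.row0 i := rfl

theorem construct_mul_natCast {t : ℤ} (ht : t = 1 ∨ t = -1) (i : ℤ) (n : ℕ) :
    d.construct x i (t * n) = d.row x t n i := by
  rcases n with _ | n
  · simp [AxisData.construct, AxisData.row]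
  · have hsign : (t * (n + 1 : ℕ)).sign = t := by
      rw [Int.sign_mul, Int.sign_natCast_of_ne_zero n.succ_ne_zero, mul_one]
      rcases ht with rfl | rfl <;> rfl
    have habs : (t * (n + 1 : ℕ)).natAbs = n + 1 := by
      rcases ht with rfl | rfl <;> omega
    rw [AxisData.construct, hsign, habs]

theorem construct_row_step {j t : ℤ} (h : Outward 0 j t) (i : ℤ) :
    d.construct x i (j + t) =
      extend (fun i => d.construct x i j) (d.col0 (j + t)) (d.col1 x (j + t)) i := by
  have ht := h.eq_one_or_eq_neg_one
  obtain ⟨n, rfl⟩ := h.exists_eq_mul_natCast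
  have hnext : t * n + t = t * (n + 1 : ℕ) := by push_cast; ring
  rw [hnext]
  simp only [construct_mul_natCast d x ht, AxisData.row]
  push_cast
  rfl

theorem construct_zero_left (h0 : d.row0 0 = d.col0 0) (j : ℤ) : d.construct x 0 j = d.col0 j :=
  outward_induction_of_zero (Q := fun j => d.construct x 0 j = d.col0 j) h0
    (fun _ _ ht _ => by rw [construct_row_step d x ht, extend_zero]) j

theorem construct_one_left (j : ℤ) : d.construct x 1 j = d.col1 x j :=
  outward_induction_of_zero (Q := fun j => d.construct x 1 j = d.col1 x j)
    (extend_zero d.col0 _ _).symm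
    (fun _ _ ht _ => by rw [construct_row_step d x ht, extend_one]) j

theorem construct_one_one : d.construct x 1 1 =
    (x.submodule, regulusLine (d.Ax 0) (d.Ax 1) (d.Ay 1) x.submodule) := by
  rw [construct_one_left, AxisData.col1, extend_one]

theorem construct_horizontal {i j s t : ℤ} (hs : Outward 1 i s) (ht : Outward 0 j t) :
    nextFlag (d.construct x i j) (d.construct x (i + s) j) (d.construct x i (j + t))
      (d.construct x (i - s) (j + t)).1 = d.construct x (i + s) (j + t) := by
  simp only [construct_row_step d x ht]
  rw [extend_step _ _ _ hs]

theorem construct_vertical (h0 : d.row0 0 = d.col0 0) {j t : ℤ} (ht : Outward 1 j t) :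
    nextFlag (d.construct x 0 j) (d.construct x 0 (j + t)) (d.construct x 1 j)
      (d.construct x 1 (j - t)).1 = d.construct x 1 (j + t) := by
  simp only [construct_zero_left d x h0, construct_one_left, AxisData.col1]
  rw [extend_step _ _ _ ht]

end Grid

section FramesFromVectors

variable {K : Type*} [Field K]

theorem join2_eq_span_rep (x y : Pt K) : join2 x y = span K {x.rep, y.rep} := by
  rw [join2, x.submodule_eq, y.submodule_eq, ← span_insert]

theorem Skew.linearIndependent_rep {x y z w : Pt K} (hxy : x ≠ y) (hzw : z ≠ w)
    (h : Skew (join2 x y) (join2 z w)) : LinearIndependent K ![x.rep, y.rep, z.rep, w.rep] := by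
  rw [join2_eq_span_rep, join2_eq_span_rep] at h
  exact h.linearIndependent_quad (Projectivization.linearIndependent_pair_iff_ne.2 hxy)
    (Projectivization.linearIndependent_pair_iff_ne.2 hzw)

theorem exists_smul_add_smul_eq {M M' W W' : Sub K} {a b v : Fin 4 → K} (hM : Skew M W)
    (hM' : Skew M' W') (ha : a ∈ M) (hb : b ∈ M') (hv : v ≠ 0) (hab : v ∈ span K {a, b})
    (hW : v ∈ W) (hW' : v ∈ W') : ∃ s t : K, s ≠ 0 ∧ t ≠ 0 ∧ s • a + t • b = v := by
  obtain ⟨s, t, rfl⟩ := mem_span_pair.1 hab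
  refine ⟨s, t, ?_, ?_, rfl⟩ <;> rintro rfl
  · exact hv (skew_iff.1 hM' _ (by simpa using M'.smul_mem t hb) hW')
  · exact hv (skew_iff.1 hM _ (by simpa using M.smul_mem s ha) hW)

theorem IsLine.mem_span_singleton {L M : Sub K} {v w : Fin 4 → K} (hL : IsLine L) (hM : IsLine M)
    (hne : L ≠ M) (hv : v ≠ 0) (hvL : v ∈ L) (hvM : v ∈ M) (hwL : w ∈ L) (hwM : w ∈ M) :
    w ∈ span K {v} := by
  by_contra hw
  have hI := linearIndependent_pair_of_notMem hv hw
  exact hne ((hL.eq_span_pair hI hvL hwL).trans (hM.eq_span_pair hI hvM hwM).symm)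

variable {f₀ f₁ f₂ f₃ g₀ g₁ g₂ g₃ v : Fin 4 → K} {m : K}

theorem QuadFrame.of_add_eq (h01 : LinearIndependent K ![f₀, g₀, f₁, g₁]) (hf : f₂ + f₃ = f₀ + f₁)
    (hg : g₀ + g₂ = f₀ + f₁) (hg' : g₁ + g₃ = f₀ + f₁) (hm : m ≠ 0)
    (hN : m • (f₀ - f₂) = g₀ - g₁) :
    QuadFrame (span K {f₀}, span K {f₀, g₀}) (span K {f₁}, span K {f₁, g₁})
      (span K {f₂}, span K {f₂, g₂}) (span K {f₃}, span K {f₃, g₃}) f₀ g₀ (f₀ + f₁) (f₀ - f₂)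
      1 m := by
  have hneg : (-1 : K) ≠ 0 := neg_ne_zero.2 one_ne_zero
  have bF : f₀ - (f₀ + f₁) = (-1 : K) • f₁ := by module
  have bG : g₀ - m • (f₀ - f₂) = (1 : K) • g₁ := by rw [hN]; module
  have cF : f₀ - (f₀ - f₂) = (1 : K) • f₂ := by module
  have cG : g₀ - (1 : K) • (f₀ + f₁) = (-1 : K) • g₂ := by rw [← hg]; module
  have dF : f₀ - (f₀ + f₁) - (f₀ - f₂) = (-1 : K) • f₃ := by rw [← hf]; module
  have dG : g₀ - (1 : K) • (f₀ + f₁) - m • (f₀ - f₂) = (-1 : K) • g₃ := by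
    rw [hN, ← hg']; module
  refine ⟨linearIndependent_quad_iff.2 fun x y z w e => ?_, one_ne_zero, hm, rfl, ?_, ?_, ?_, rfl,
    ?_, ?_, ?_⟩
  · obtain ⟨hx, hy, hz, hw⟩ := linearIndependent_quad_iff.1 h01 (m * (x + z)) (m * y + w) (m * z)
      (-w) (by linear_combination (norm := module) m • e - w • hN)
    obtain rfl : w = 0 := neg_eq_zero.1 hw
    simp_all
  · rw [bF, span_singleton_smul_eq (.mk0 _ hneg)]
  · rw [cF, one_smul]
  · rw [dF, span_singleton_smul_eq (.mk0 _ hneg)]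
  · rw [bF, bG, span_pair_smul_smul hneg one_ne_zero]
  · rw [cF, cG, span_pair_smul_smul one_ne_zero hneg]
  · rw [dF, dG, span_pair_smul_smul hneg hneg]

theorem QuadFrame.of_smul_add_smul_eq {α₀ α₁ α₂ α₃ β₀ β₁ β₂ β₃ : K}
    (h01 : LinearIndependent K ![f₀, g₀, f₁, g₁]) (hα₀ : α₀ ≠ 0) (hα₁ : α₁ ≠ 0) (hα₂ : α₂ ≠ 0)
    (hα₃ : α₃ ≠ 0) (hβ₀ : β₀ ≠ 0) (hβ₁ : β₁ ≠ 0) (hβ₂ : β₂ ≠ 0) (hβ₃ : β₃ ≠ 0)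
    (e01 : α₀ • f₀ + α₁ • f₁ = v) (e23 : α₂ • f₂ + α₃ • f₃ = v) (e02 : β₀ • g₀ + β₂ • g₂ = v)
    (e13 : β₁ • g₁ + β₃ • g₃ = v) (hm : m ≠ 0)
    (hN : m • (α₀ • f₀ - α₂ • f₂) = β₀ • g₀ - β₁ • g₁) :
    QuadFrame (span K {f₀}, span K {f₀, g₀}) (span K {f₁}, span K {f₁, g₁})
      (span K {f₂}, span K {f₂, g₂}) (span K {f₃}, span K {f₃, g₃})
      (α₀ • f₀) (β₀ • g₀) v (α₀ • f₀ - α₂ • f₂) 1 m := by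
  have hI := linearIndependent_quad_smul h01 hα₀ hβ₀ hα₁ hβ₁
  have hframe := QuadFrame.of_add_eq hI (e23.trans e01.symm) (e02.trans e01.symm)
    (e13.trans e01.symm) hm hN
  rwa [e01, span_pair_smul_smul hα₀ hβ₀, span_pair_smul_smul hα₁ hβ₁, span_pair_smul_smul hα₂ hβ₂,
    span_pair_smul_smul hα₃ hβ₃, span_singleton_smul_eq (.mk0 _ hα₀),
    span_singleton_smul_eq (.mk0 _ hα₁), span_singleton_smul_eq (.mk0 _ hα₂),
    span_singleton_smul_eq (.mk0 _ hα₃)] at hframe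

theorem QuadFrame.exists_of_span (h01 : LinearIndependent K ![f₀, g₀, f₁, g₁])
    (h02 : LinearIndependent K ![f₀, g₀, f₂, g₂]) (h13 : LinearIndependent K ![f₁, g₁, f₃, g₃])
    (h23 : LinearIndependent K ![f₂, g₂, f₃, g₃]) (hv : v ≠ 0)
    (hf : v ∈ span K {f₀, f₁} ⊓ span K {f₂, f₃}) (hg : v ∈ span K {g₀, g₂} ⊓ span K {g₁, g₃})
    (hk : span K {f₀, f₂} ⊓ span K {f₁, f₃} ≤ span K {g₀, g₁} ⊓ span K {g₂, g₃})
    (hne : span K {g₀, g₁} ≠ span K {g₂, g₃}) :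
    ∃ F G H N l m, QuadFrame (span K {f₀}, span K {f₀, g₀}) (span K {f₁}, span K {f₁, g₁})
      (span K {f₂}, span K {f₂, g₂}) (span K {f₃}, span K {f₃, g₃}) F G H N l m := by
  obtain ⟨hf₀, hf₂⟩ := mem_inf.1 hf
  obtain ⟨hg₀, hg₁⟩ := mem_inf.1 hg
  have s01 : Skew (span K {f₀, f₁}) (span K {g₀, g₁}) :=
    skew_span_pair (linearIndependent_quad_swap h01)
  have s02 : Skew (span K {f₀, f₂}) (span K {g₀, g₂}) :=
    skew_span_pair (linearIndependent_quad_swap h02)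
  have s13 : Skew (span K {f₁, f₃}) (span K {g₁, g₃}) :=
    skew_span_pair (linearIndependent_quad_swap h13)
  have s23 : Skew (span K {f₂, f₃}) (span K {g₂, g₃}) :=
    skew_span_pair (linearIndependent_quad_swap h23)
  have hl (a b : Fin 4 → K) : a ∈ span K {a, b} := subset_span (by simp)
  have hr (a b : Fin 4 → K) : b ∈ span K {a, b} := subset_span (by simp)
  obtain ⟨α₀, α₁, hα₀, hα₁, e01⟩ :=
    exists_smul_add_smul_eq s02 s13 (hl _ _) (hl _ _) hv hf₀ hg₀ hg₁
  obtain ⟨α₂, α₃, hα₂, hα₃, e23⟩ :=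
    exists_smul_add_smul_eq s02 s13 (hr _ _) (hr _ _) hv hf₂ hg₀ hg₁
  obtain ⟨β₀, β₂, hβ₀, hβ₂, e02⟩ :=
    exists_smul_add_smul_eq s01.symm s23.symm (hl _ _) (hl _ _) hv hg₀ hf₀ hf₂
  obtain ⟨β₁, β₃, hβ₁, hβ₃, e13⟩ :=
    exists_smul_add_smul_eq s01.symm s23.symm (hr _ _) (hr _ _) hv hg₁ hf₀ hf₂
  obtain ⟨hN, hN'⟩ := mem_inf.1 (hk (mem_inf.2 ⟨mem_span_pair.2 ⟨α₀, -α₂, by module⟩,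
    mem_span_pair.2 ⟨-α₁, α₃, by linear_combination (norm := module) e23 - e01⟩⟩ :
      α₀ • f₀ - α₂ • f₂ ∈ _))
  have hN0 : α₀ • f₀ - α₂ • f₂ ≠ 0 := fun h0 => hα₀ (linearIndependent_quad_iff.1 h02 α₀ 0 (-α₂) 0
    (by linear_combination (norm := module) h0)).1
  have hgg := linearIndependent_right_pair (linearIndependent_quad_swap h01)
  have hgg' := linearIndependent_right_pair (linearIndependent_quad_swap h23)
  obtain ⟨m, hm⟩ := mem_span_singleton.1 <| (isLine_span_pair hgg).mem_span_singleton
    (isLine_span_pair hgg') hne hN0 hN hN' (mem_span_pair.2 ⟨β₀, -β₁, rfl⟩)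
    (mem_span_pair.2 ⟨-β₂, β₃, by linear_combination (norm := module) e13 - e02⟩)
  have hm0 : m ≠ 0 := by
    rintro rfl
    exact hβ₀ (LinearIndependent.pair_iff.1 hgg β₀ (-β₁) (by rw [← hm, zero_smul])).1
  exact ⟨_, _, _, _, _, _, QuadFrame.of_smul_add_smul_eq h01 hα₀ hα₁ hα₂ hα₃ hβ₀ hβ₁ hβ₂ hβ₃ e01 e23
    e02 e13 hm0 (hm.trans (by module))⟩

end FramesFromVectors

section Transposition

variable {K : Type*} [Field K] {f g h k : Net K} {A : Congruence K}

theorem face_swap (f : Net K) (i j : ℤ) : face (Function.swap f) i j = face f j i :=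
  sup_sup_sup_comm _ _ _ _

theorem IsConjugate.swap (hf : IsConjugate f) : IsConjugate (Function.swap f) := fun i j =>
  face_swap f i j ▸ hf j i

theorem IsRegular.swap (hf : IsRegular f) : IsRegular (Function.swap f) where
  osc1_plane i j := hf.osc2_plane j i
  osc2_plane i j := hf.osc1_plane j i
  not_collinear i j := face_swap f i j ▸ hf.not_collinear j i

theorem IsLaplace1.swap (hf : IsLaplace1 f h) : IsLaplace2 (Function.swap f) (Function.swap h) :=
  fun i j => hf j i

theorem IsLaplace2.swap (hf : IsLaplace2 f k) : IsLaplace1 (Function.swap f) (Function.swap k) :=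
  fun i j => hf j i

theorem AdjacentSkew.swap (hA : AdjacentSkew A) : AdjacentSkew (Function.swap A) := fun i j =>
  (hA j i).symm

theorem IsLaplaceCycle.swap (hc : IsLaplaceCycle f h g k) :
    IsLaplaceCycle (Function.swap f) (Function.swap k) (Function.swap g) (Function.swap h) where
  f_conj := hc.f_conj.swap
  h_conj := hc.k_conj.swap
  g_conj := hc.g_conj.swap
  k_conj := hc.h_conj.swap
  f_reg := hc.f_reg.swap
  h_reg := hc.k_reg.swap
  g_reg := hc.g_reg.swap
  k_reg := hc.h_reg.swap
  h_eq := hc.k_eq.swap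
  k_eq := hc.h_eq.swap
  g_eq_first := hc.g_eq_second.swap
  g_eq_second := hc.g_eq_first.swap

theorem InGeneralPosition.swap (hp : InGeneralPosition f h g k) :
    InGeneralPosition (Function.swap f) (Function.swap k) (Function.swap g) (Function.swap h) where
  f_ne_g i j := hp.f_ne_g j i
  h_ne_k i j := (hp.h_ne_k j i).symm
  osc_f i j := (hp.osc_f j i).symm
  osc_h i j := (hp.osc_k j i).symm
  osc_g i j := (hp.osc_g j i).symm
  osc_k i j := (hp.osc_h j i).symm
  skew := hp.skew.swap

end Transposition

section Cycles

variable {K : Type*} [Field K] {f g h k : Net K}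

theorem eq_join2 {L : Sub K} {x y : Pt K} (hL : finrank K L ≤ 2) (h : x ≠ y)
    (hx : x.submodule ≤ L) (hy : y.submodule ≤ L) : join2 x y = L :=
  eq_of_le_of_finrank_le (sup_le hx hy) (hL.trans_eq (isLine_join2 h).symm)

theorem IsRegular.ne_horizontal (hf : IsRegular f) (i j : ℤ) : f i j ≠ f (i + 1) j := fun e => by
  have hplane := hf.osc1_plane i j
  rw [osc1, join3, ← e, sup_assoc, sup_idem] at hplane
  have hle : finrank K (join2 (f (i - 1) j) (f i j)) ≤ 2 := finrank_join2_le _ _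
  rw [join2, hplane] at hle
  omega

theorem IsRegular.ne_vertical (hf : IsRegular f) (i j : ℤ) : f i j ≠ f i (j + 1) :=
  hf.swap.ne_horizontal j i

theorem IsRegular.join_ne (hf : IsRegular f) (i j : ℤ) :
    join2 (f i j) (f (i + 1) j) ≠ join2 (f i (j + 1)) (f (i + 1) (j + 1)) := fun e => by
  have hface := hf.not_collinear i j
  rw [face, ← e, sup_idem] at hface
  exact hface.not_ge (finrank_join2_le _ _)

namespace IsLaplaceCycle

theorem h_le_join2_f (hc : IsLaplaceCycle f h g k) (i j : ℤ) :
    (h i j).submodule ≤ join2 (f i j) (f (i + 1) j) := (hc.h_eq i j).trans_le inf_le_left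

theorem join2_g_vertical (hc : IsLaplaceCycle f h g k) (i j : ℤ) :
    join2 (g i j) (g i (j + 1)) = join2 (h (i - 1) j) (h i j) := by
  have hg := hc.g_eq_first (i - 1)
  simp only [sub_add_cancel] at hg
  refine eq_join2 (finrank_join2_le _ _) (hc.g_reg.ne_vertical i j) ?_ ?_
  · exact (sub_add_cancel j 1 ▸ hg (j - 1)).trans_le inf_le_right
  · exact (hg j).trans_le inf_le_left

theorem diagonal_le_osc1 (hc : IsLaplaceCycle f h g k) (i j : ℤ) :
    diagonal f g i j ≤ osc1 f i j := by
  have hprev : (h (i - 1) j).submodule ≤ osc1 f i j :=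
    (sub_add_cancel i 1 ▸ hc.h_le_join2_f (i - 1) j).trans le_sup_left
  have hnext : (h i j).submodule ≤ osc1 f i j :=
    (hc.h_le_join2_f i j).trans (sup_le_sup_right le_sup_right _)
  refine sup_le (le_sup_right.trans le_sup_left) (le_trans ?_ (sup_le hprev hnext))
  exact le_sup_left.trans (hc.join2_g_vertical i j).le

theorem diagonal_le_osc2 (hc : IsLaplaceCycle f h g k) (i j : ℤ) :
    diagonal f g i j ≤ osc2 f i j := hc.swap.diagonal_le_osc1 j i

theorem h_le_join2_g (hc : IsLaplaceCycle f h g k) (i j : ℤ) :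
    (h i j).submodule ≤ join2 (g i j) (g i (j + 1)) ⊓ join2 (g (i + 1) j) (g (i + 1) (j + 1)) := by
  rw [hc.join2_g_vertical, hc.join2_g_vertical, add_sub_cancel_right]
  exact le_inf le_sup_right le_sup_left

theorem exists_quadFrame (hc : IsLaplaceCycle f h g k) (hp : InGeneralPosition f h g k) (i j : ℤ) :
    ∃ F G H N l m, QuadFrame (cycleFlag f g i j) (cycleFlag f g (i + 1) j)
      (cycleFlag f g i (j + 1)) (cycleFlag f g (i + 1) (j + 1)) F G H N l m := by
  have hindep {i j i' j' : ℤ} (hs : Skew (diagonal f g i j) (diagonal f g i' j')) :=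
    hs.linearIndependent_rep (hp.f_ne_g i j) (hp.f_ne_g i' j')
  have hf := (hc.h_eq i j).le
  have hg := hc.h_le_join2_g i j
  have hk := (hc.k_eq i j).ge.trans (hc.swap.h_le_join2_g j i)
  have hne := hc.g_reg.join_ne i j
  simp only [Function.swap, join2_eq_span_rep] at hf hg hk hne
  simp only [(h i j).submodule_eq, span_singleton_le_iff_mem] at hf hg
  simp only [cycleFlag, diagonal, join2_eq_span_rep, Projectivization.submodule_eq]
  exact QuadFrame.exists_of_span (hindep (hp.skew i j).1) (hindep (hp.skew i j).2)
    (hindep (hp.skew (i + 1) j).2) (hindep (hp.skew i (j + 1)).1) (h i j).rep_nonzero hf hg hk hne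

end IsLaplaceCycle

end Cycles

section Signs

variable {K : Type*} [Field K] {A : Congruence K} {i j s t : ℤ}

theorem AdjacentSkew.horizontal (hA : AdjacentSkew A) (i j : ℤ) (hs : s = 1 ∨ s = -1) :
    Skew (A i j) (A (i + s) j) := by
  rcases hs with rfl | rfl
  · exact (hA i j).1
  · simpa using (hA (i + -1) j).1.symm

theorem AdjacentSkew.vertical (hA : AdjacentSkew A) (i j : ℤ) (ht : t = 1 ∨ t = -1) :
    Skew (A i j) (A i (j + t)) := hA.swap.horizontal j i ht

theorem OppositeSkew.diagonals (hA : OppositeSkew A) (i j : ℤ) (hs : s = 1 ∨ s = -1)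
    (ht : t = 1 ∨ t = -1) :
    Skew (A i j) (A (i + s) (j + t)) ∧ Skew (A (i + s) j) (A i (j + t)) := by
  have right {i t : ℤ} (ht : t = 1 ∨ t = -1) :
      Skew (A i j) (A (i + 1) (j + t)) ∧ Skew (A (i + 1) j) (A i (j + t)) := by
    rcases ht with rfl | rfl
    · exact hA i j
    · have hA := hA i (j + -1)
      rw [neg_add_cancel_right] at hA
      exact ⟨hA.2.symm, hA.1.symm⟩
  rcases hs with rfl | rfl
  · exact right ht
  · simpa using (right (i := i + -1) ht).symm

theorem le_osc1 (f : Net K) (i j : ℤ) (hs : s = 1 ∨ s = -1) :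
    (f (i + s) j).submodule ≤ osc1 f i j := by
  rcases hs with rfl | rfl
  · exact le_sup_right
  · exact le_sup_left.trans le_sup_left

theorem finrank_join3_le (x y z : Pt K) : finrank K (join3 x y z) ≤ 3 := by
  have := finrank_add_le_finrank_add_finrank (join2 x y) z.submodule
  rw [z.finrank_submodule] at this
  exact this.trans (Nat.add_le_add_right (finrank_join2_le x y) 1)

theorem finrank_sup_le_three {x A : Sub K} (hx : finrank K x ≤ 1) (hA : IsLine A) :
    finrank K (x ⊔ A : Sub K) ≤ 3 :=
  (finrank_add_le_finrank_add_finrank x A).trans (add_le_add hx hA.le)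

theorem le_sup_of_le_osc1 {f : Net K} {A : Sub K} (hA : IsLine A) (ho : A ≤ osc1 f i j)
    (hs : s = 1 ∨ s = -1) (hf : ¬ (f (i - s) j).submodule ≤ A) :
    (f (i + s) j).submodule ≤ (f (i - s) j).submodule ⊔ A := by
  have hprev : (f (i - s) j).submodule ≤ osc1 f i j :=
    sub_eq_add_neg i s ▸ le_osc1 f i j (by omega)
  have hplane : osc1 f i j = (f (i - s) j).submodule ⊔ A :=
    plane_eq_of_line_le_of_point_le hA hf (finrank_join3_le _ _ _)
      (finrank_sup_le_three (Projectivization.finrank_submodule _).le hA) ho le_sup_right hprev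
      le_sup_left
  exact hplane ▸ le_osc1 f i j hs

end Signs

section FrameNets

variable {K : Type*} [Field K] {a b : ℤ → ℤ → Flag K} {i j s t : ℤ}

/-- The flags at the vertices of every elementary quadrilateral have a normal form. -/
def HasFrames (a : ℤ → ℤ → Flag K) : Prop :=
  ∀ i j, ∃ F G H N l m, QuadFrame (a i j) (a (i + 1) j) (a i (j + 1)) (a (i + 1) (j + 1))
    F G H N l m

theorem HasFrames.swap (ha : HasFrames a) : HasFrames (Function.swap a) := fun i j => by
  obtain ⟨F, G, H, N, l, m, h⟩ := ha j i
  exact ⟨_, _, _, _, _, _, h.swap⟩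

theorem HasFrames.exists_quadFrame (ha : HasFrames a) (i j : ℤ) (hs : s = 1 ∨ s = -1)
    (ht : t = 1 ∨ t = -1) :
    ∃ F G H N l m, QuadFrame (a i j) (a (i + s) j) (a i (j + t)) (a (i + s) (j + t))
      F G H N l m := by
  have right (i : ℤ) : ∃ F G H N l m, QuadFrame (a i j) (a (i + 1) j) (a i (j + t))
      (a (i + 1) (j + t)) F G H N l m := by
    rcases ht with rfl | rfl
    · exact ha i j
    · obtain ⟨F, G, H, N, l, m, h⟩ := ha i (j + -1)
      rw [neg_add_cancel_right] at h
      exact ⟨_, _, _, _, _, _, h.flip_snd⟩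
  rcases hs with rfl | rfl
  · exact right i
  · obtain ⟨F, G, H, N, l, m, h⟩ := right (i + -1)
    rw [neg_add_cancel_right] at h
    exact ⟨_, _, _, _, _, _, h.flip_fst⟩

/-- A family of flags whose elementary quadrilaterals have normal forms, such that three successive
points on a parameter line are coplanar with the line at the middle vertex.  This is what the
projection steps need to know about a cycle. -/
structure IsFrameNet (a : ℤ → ℤ → Flag K) : Prop where
  hasFrames : HasFrames a
  le_horizontal : ∀ {i j s}, s = 1 ∨ s = -1 → (a (i + s) j).1 ≤ (a (i - s) j).1 ⊔ (a i j).2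
  le_vertical : ∀ {i j t}, t = 1 ∨ t = -1 → (a i (j + t)).1 ≤ (a i (j - t)).1 ⊔ (a i j).2

namespace IsFrameNet

theorem swap (ha : IsFrameNet a) : IsFrameNet (Function.swap a) where
  hasFrames := ha.hasFrames.swap
  le_horizontal := ha.le_vertical
  le_vertical := ha.le_horizontal

theorem finrank_sup_le (ha : IsFrameNet a) (i j i' j' : ℤ) :
    finrank K ((a i j).1 ⊔ (a i' j').2 : Sub K) ≤ 3 := by
  obtain ⟨F, G, H, N, l, m, h⟩ := ha.hasFrames i j
  obtain ⟨F', G', H', N', l', m', h'⟩ := ha.hasFrames i' j'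
  refine finrank_sup_le_three ?_ h'.isLine_a
  rw [h.a_pt, finrank_span_singleton h.F_ne]

theorem nextFlag_horizontal (ha : IsFrameNet a) (hs : s = 1 ∨ s = -1) (ht : t = 1 ∨ t = -1)
    (hskew : Skew (a (i + s) j).2 (a i (j + t)).2) :
    nextFlag (a i j) (a (i + s) j) (a i (j + t)) (a (i - s) (j + t)).1 = a (i + s) (j + t) := by
  obtain ⟨F, G, H, N, l, m, h⟩ := ha.hasFrames.exists_quadFrame i j hs ht
  exact h.nextFlag_eq (h.ne_of_skew hskew) (ha.finrank_sup_le _ _ _ _) (ha.le_horizontal hs)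

theorem nextFlag_vertical (ha : IsFrameNet a) (hs : s = 1 ∨ s = -1) (ht : t = 1 ∨ t = -1)
    (hskew : Skew (a (i + s) j).2 (a i (j + t)).2) :
    nextFlag (a i j) (a i (j + t)) (a (i + s) j) (a (i + s) (j - t)).1 = a (i + s) (j + t) :=
  ha.swap.nextFlag_horizontal ht hs hskew.symm

theorem eq_horizontal (ha : IsFrameNet a) (hb : IsFrameNet b) (hs : s = 1 ∨ s = -1)
    (ht : t = 1 ∨ t = -1) (h₁ : a i j = b i j) (h₂ : a (i + s) j = b (i + s) j)
    (h₃ : a i (j + t) = b i (j + t)) (h₄ : a (i - s) (j + t) = b (i - s) (j + t)) :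
    a (i + s) (j + t) = b (i + s) (j + t) := by
  obtain ⟨F, G, H, N, l, m, h⟩ := ha.hasFrames.exists_quadFrame i j hs ht
  obtain ⟨F', G', H', N', l', m', h'⟩ := hb.hasFrames.exists_quadFrame i j hs ht
  rw [← h₁, ← h₂, ← h₃] at h'
  have hd := hb.le_horizontal (i := i) (j := j + t) hs
  rw [← h₃, ← h₄] at hd
  exact h.eq_of_plane h' (ha.finrank_sup_le _ _ _ _) le_sup_right (ha.le_horizontal hs) hd

theorem eq_vertical (ha : IsFrameNet a) (hb : IsFrameNet b) (hs : s = 1 ∨ s = -1)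
    (ht : t = 1 ∨ t = -1) (h₁ : a i j = b i j) (h₂ : a i (j + t) = b i (j + t))
    (h₃ : a (i + s) j = b (i + s) j) (h₄ : a (i + s) (j - t) = b (i + s) (j - t)) :
    a (i + s) (j + t) = b (i + s) (j + t) :=
  ha.swap.eq_horizontal hb.swap ht hs h₁ h₂ h₃ h₄

theorem eq_of_eq_on_axes (ha : IsFrameNet a) (hb : IsFrameNet b) (hx : ∀ i, a i 0 = b i 0)
    (hy : ∀ j, a 0 j = b 0 j) (h11 : (a 1 1).1 = (b 1 1).1) : a = b := by
  funext i j
  refine grid_induction (P := fun i j => a i j = b i j) hx hy ?_ ?_ ?_ i j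
  · obtain ⟨F, G, H, N, l, m, h⟩ := ha.hasFrames 0 0
    obtain ⟨F', G', H', N', l', m', h'⟩ := hb.hasFrames 0 0
    simp only [zero_add] at h h'
    rw [← hx 0, ← hx 1, ← hy 1] at h'
    exact h.eq_of_point h' h11
  · intro j t ht h₁ h₂ h₃ h₄
    exact ha.eq_vertical hb (i := 0) (s := 1) (.inl rfl) ht.eq_one_or_eq_neg_one h₁ h₂ h₃ h₄
  · intro i j s t hs ht
    exact ha.eq_horizontal hb hs.eq_one_or_eq_neg_one ht.eq_one_or_eq_neg_one

end IsFrameNet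

end FrameNets

section CycleProperties

variable {K : Type*} [Field K] {f g h k f' g' h' k' : Net K}

theorem IsLaplace1.unique (hh : IsLaplace1 f h) (hh' : IsLaplace1 f h') : h = h' :=
  funext fun i => funext fun j => Projectivization.submodule_injective
    ((hh i j).trans (hh' i j).symm)

theorem IsLaplace2.unique (hk : IsLaplace2 f k) (hk' : IsLaplace2 f k') : k = k' :=
  congrArg Function.swap (hk.swap.unique hk'.swap)

namespace IsLaplaceCycle

theorem le_sup_diagonal (hc : IsLaplaceCycle f h g k) (hp : InGeneralPosition f h g k) (i j : ℤ)
    {s : ℤ} (hs : s = 1 ∨ s = -1) :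
    (f (i + s) j).submodule ≤ (f (i - s) j).submodule ⊔ diagonal f g i j :=
  have hskew : Skew (diagonal f g (i - s) j) (diagonal f g i j) := by
    simpa using hp.skew.horizontal (i - s) j hs
  le_sup_of_le_osc1 (isLine_join2 (hp.f_ne_g i j)) (hc.diagonal_le_osc1 i j) hs
    (Pt.not_le_of_skew hskew le_sup_left)

theorem isFrameNet (hc : IsLaplaceCycle f h g k) (hp : InGeneralPosition f h g k) :
    IsFrameNet (cycleFlag f g) where
  hasFrames := hc.exists_quadFrame hp
  le_horizontal := hc.le_sup_diagonal hp _ _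
  le_vertical := hc.swap.le_sup_diagonal hp.swap _ _

theorem nextFlag_eq (hc : IsLaplaceCycle f h g k) (hp : InGeneralPosition f h g k)
    (ho : OppositeSkew (diagonal f g)) (i j : ℤ) {s t : ℤ} (hs : s = 1 ∨ s = -1)
    (ht : t = 1 ∨ t = -1) :
    nextFlag (cycleFlag f g i j) (cycleFlag f g (i + s) j) (cycleFlag f g i (j + t))
        (cycleFlag f g (i - s) (j + t)).1 = cycleFlag f g (i + s) (j + t) ∧
      nextFlag (cycleFlag f g i j) (cycleFlag f g i (j + t)) (cycleFlag f g (i + s) j)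
        (cycleFlag f g (i + s) (j - t)).1 = cycleFlag f g (i + s) (j + t) :=
  have hskew := (ho.diagonals i j hs ht).2
  ⟨(hc.isFrameNet hp).nextFlag_horizontal hs ht hskew,
    (hc.isFrameNet hp).nextFlag_vertical hs ht hskew⟩

theorem isSuitable (hc : IsLaplaceCycle f h g k) (hp : InGeneralPosition f h g k) :
    (axisData f g).IsSuitable where
  f_origin := rfl
  A_origin := rfl
  line_x i := isLine_join2 (hp.f_ne_g i 0)
  line_y i := isLine_join2 (hp.f_ne_g 0 i)
  skew_x i := (hp.skew i 0).1
  skew_y i := (hp.skew 0 i).2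
  osc_x i := hc.diagonal_le_osc1 i 0
  osc_y i := hc.diagonal_le_osc2 0 i
  mem_x _ := le_sup_left
  mem_y _ := le_sup_left

theorem mem_conic (hc : IsLaplaceCycle f h g k) (hp : InGeneralPosition f h g k)
    (hs : Skew (diagonal f g 1 0) (diagonal f g 0 1)) : f 1 1 ∈ (axisData f g).conic := by
  obtain ⟨F, G, H, N, l, m, hF⟩ := hc.exists_quadFrame hp 0 0
  exact ⟨⟨_, hF.line_mem_regulus (hF.ne_of_skew hs), hF.d_le⟩, hF.d_le_sup⟩

theorem unique (hc : IsLaplaceCycle f h g k) (hp : InGeneralPosition f h g k)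
    (hc' : IsLaplaceCycle f' h' g' k') (hp' : InGeneralPosition f' h' g' k')
    (hd : axisData f g = axisData f' g') (h11 : f 1 1 = f' 1 1) :
    f = f' ∧ h = h' ∧ g = g' ∧ k = k' := by
  have hflag : cycleFlag f g = cycleFlag f' g' :=
    (hc.isFrameNet hp).eq_of_eq_on_axes (hc'.isFrameNet hp')
      (congrFun (congrArg AxisData.row0 hd)) (congrFun (congrArg AxisData.col0 hd))
      (congrArg Projectivization.submodule h11)
  obtain rfl : f = f' := funext fun i => funext fun j =>
    Projectivization.submodule_injective (congrArg Prod.fst (congrFun₂ hflag i j))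
  obtain rfl := hc.h_eq.unique hc'.h_eq
  obtain rfl := hc.k_eq.unique hc'.k_eq
  have hg := hc.g_eq_first.unique hc'.g_eq_first
  refine ⟨rfl, rfl, funext fun i => funext fun j => ?_, rfl⟩
  simpa using congrFun₂ hg (i - 1) (j - 1)

theorem construct_eq (hc : IsLaplaceCycle f h g k) (hp : InGeneralPosition f h g k)
    (ho : OppositeSkew (diagonal f g)) (i j : ℤ) :
    (axisData f g).construct (f 1 1) i j = cycleFlag f g i j := by
  revert i j
  refine grid_induction (construct_zero_right _ _) (construct_zero_left _ _ rfl) ?_ ?_ ?_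
  · obtain ⟨F, G, H, N, l, m, hF⟩ := hc.exists_quadFrame hp 0 0
    exact (construct_one_one _ _).trans
      (Prod.ext rfl (hF.regulusLine_eq (hF.ne_of_skew (ho 0 0).2)))
  · intro j t ht h₁ h₂ h₃ h₄
    rw [← construct_vertical _ _ rfl ht, h₁, h₂, h₃, h₄]
    exact (hc.nextFlag_eq hp ho 0 j (s := 1) (.inl rfl) ht.eq_one_or_eq_neg_one).2
  · intro i j s t hs ht h₁ h₂ h₃ h₄
    rw [← construct_horizontal _ _ hs ht, h₁, h₂, h₃, h₄]
    exact (hc.nextFlag_eq hp ho i j hs.eq_one_or_eq_neg_one ht.eq_one_or_eq_neg_one).1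

theorem constructionRegular (hc : IsLaplaceCycle f h g k) (hp : InGeneralPosition f h g k)
    (ho : OppositeSkew (diagonal f g)) : (axisData f g).ConstructionRegular (f 1 1) :=
  ⟨f, diagonal f g, hc.construct_eq hp ho, fun i j => isLine_join2 (hp.f_ne_g i j), hp.skew, ho,
    hc.f_reg, hp.osc_f, fun _ hh => hc.h_eq.unique hh ▸ hc.h_reg,
    fun _ hk => hc.k_eq.unique hk ▸ hc.k_reg⟩

end IsLaplaceCycle

end CycleProperties

section Existence

variable {K : Type*} [Field K]

theorem Pt.eq_inf {L M : Sub K} {x : Pt K} (hL : IsLine L) (hM : IsLine M) (hne : L ≠ M)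
    (hxL : x.submodule ≤ L) (hxM : x.submodule ≤ M) : x.submodule = L ⊓ M := by
  have hlt : L ⊓ M < L := inf_lt_left.2 fun h => hne (hL.eq_of_le hM h)
  refine eq_of_le_of_finrank_le (le_inf hxL hxM) ?_
  rw [x.finrank_submodule]
  exact Nat.lt_succ_iff.1 ((finrank_lt_finrank_of_lt hlt).trans_eq hL)

theorem QuadFrame.span_H_eq {a b c d : Flag K} {F G H N : Fin 4 → K} {l m : K}
    (h : QuadFrame a b c d F G H N l m) : span K {H} = (a.1 ⊔ b.1) ⊓ (c.1 ⊔ d.1) := by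
  rw [h.a_pt, h.b_pt, h.c_pt, h.d_pt, ← span_insert, ← span_insert]
  refine le_antisymm ?_ fun v hv => ?_
  · rw [span_singleton_le_iff_mem]
    exact ⟨mem_span_pair.2 ⟨1, -1, by module⟩, mem_span_pair.2 ⟨1, -1, by module⟩⟩
  · obtain ⟨s, t, rfl⟩ := mem_span_pair.1 hv.1
    obtain ⟨p, q, e⟩ := mem_span_pair.1 hv.2
    obtain ⟨hF, -, -, hN⟩ := h.coeff_eq_zero (x := p + q - s - t) (y := 0) (z := t - q)
      (w := -p - q) (by linear_combination (norm := module) e)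
    obtain rfl : s = -t := by linear_combination -hF - hN
    exact mem_span_singleton.2 ⟨-t, by module⟩

/-- A normal form of the quadrilateral `(i, j)` of a Laplace cycle `f, h, g, k`: the normal form
`QuadFrame` of the quadrilateral of `f` and the diagonal congruence, whose vectors represent the
points of all four nets. -/
structure CycleFrame (f h g k : Net K) (i j : ℤ) (F G H N : Fin 4 → K) (l m : K) : Prop where
  frame : QuadFrame (cycleFlag f g i j) (cycleFlag f g (i + 1) j)
    (cycleFlag f g i (j + 1)) (cycleFlag f g (i + 1) (j + 1)) F G H N l m
  g_a : (g i j).submodule = span K {G}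
  g_b : (g (i + 1) j).submodule = span K {G - m • N}
  g_c : (g i (j + 1)).submodule = span K {G - l • H}
  g_d : (g (i + 1) (j + 1)).submodule = span K {G - l • H - m • N}
  h_eq : (h i j).submodule = span K {H}
  k_eq : (k i j).submodule = span K {N}

/-- All quadrilaterals of the four nets have a normal form `CycleFrame`. -/
def HasCycleFrames (f h g k : Net K) : Prop :=
  ∀ i j, ∃ F G H N l m, CycleFrame f h g k i j F G H N l m

variable {f h g k : Net K} {A : Congruence K} {i j : ℤ} {F G H N : Fin 4 → K} {l m : K}

namespace CycleFrame

theorem swap (hF : CycleFrame f h g k i j F G H N l m) :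
    CycleFrame (Function.swap f) (Function.swap k) (Function.swap g) (Function.swap h) j i
      F G N H m l where
  frame := hF.frame.swap
  g_a := hF.g_a
  g_b := hF.g_c
  g_c := hF.g_b
  g_d := by
    rw [sub_right_comm]
    exact hF.g_d
  h_eq := hF.k_eq
  k_eq := hF.h_eq

theorem h_le_join2_g_left (hF : CycleFrame f h g k i j F G H N l m) :
    (h i j).submodule ≤ join2 (g i j) (g i (j + 1)) := by
  rw [join2, hF.h_eq, hF.g_a, hF.g_c, ← span_insert, span_singleton_le_iff_mem]
  exact (smul_mem_iff _ hF.frame.l_ne).1 (mem_span_pair.2 ⟨1, -1, by module⟩)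

theorem h_le_join2_g_right (hF : CycleFrame f h g k i j F G H N l m) :
    (h i j).submodule ≤ join2 (g (i + 1) j) (g (i + 1) (j + 1)) := by
  rw [join2, hF.h_eq, hF.g_b, hF.g_d, ← span_insert, span_singleton_le_iff_mem]
  exact (smul_mem_iff _ hF.frame.l_ne).1 (mem_span_pair.2 ⟨1, -1, by module⟩)

theorem finrank_face_f_le (hF : CycleFrame f h g k i j F G H N l m) :
    finrank K (face f i j) ≤ 3 := by
  have hle : face f i j ≤ join3 (f i j) (f (i + 1) j) (f i (j + 1)) :=
    sup_le le_sup_left (sup_le le_sup_right hF.frame.d_le_sup)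
  exact (finrank_mono hle).trans (finrank_join3_le _ _ _)

theorem finrank_face_g_le (hF : CycleFrame f h g k i j F G H N l m) :
    finrank K (face g i j) ≤ 3 := by
  have hd : (g (i + 1) (j + 1)).submodule ≤ join3 (g i j) (g (i + 1) j) (g i (j + 1)) := by
    rw [join3, hF.g_a, hF.g_b, hF.g_c, hF.g_d, span_singleton_le_iff_mem,
      mem_span_sup_span_sup_span]
    exact ⟨-1, 1, 1, by module⟩
  have hle : face g i j ≤ join3 (g i j) (g (i + 1) j) (g i (j + 1)) :=
    sup_le le_sup_left (sup_le le_sup_right hd)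
  exact (finrank_mono hle).trans (finrank_join3_le _ _ _)

theorem two_lt_finrank_face_g (hF : CycleFrame f h g k i j F G H N l m) :
    2 < finrank K (face g i j) := by
  have hG : G ∈ face g i j := by
    rw [← span_singleton_le_iff_mem, ← hF.g_a]
    exact le_sup_left.trans le_sup_left
  have hH : H ∈ face g i j := by
    rw [← span_singleton_le_iff_mem, ← hF.h_eq]
    exact hF.h_le_join2_g_left.trans
      (sup_le (le_sup_left.trans le_sup_left) (le_sup_left.trans le_sup_right))
  have hN : N ∈ face g i j := by
    rw [← span_singleton_le_iff_mem, ← hF.k_eq]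
    exact hF.swap.h_le_join2_g_left.trans le_sup_left
  have hindep : LinearIndependent K (![F, G, H, N] ∘ ![1, 2, 3]) :=
    hF.frame.indep.comp _ (by decide)
  have hle : span K (Set.range (![F, G, H, N] ∘ ![1, 2, 3])) ≤ face g i j := by
    rw [span_le, Set.range_subset_iff]
    intro n
    fin_cases n
    exacts [hG, hH, hN]
  have hcard := finrank_mono hle
  rwa [finrank_span_eq_card hindep] at hcard

theorem f_ne_g (hF : CycleFrame f h g k i j F G H N l m) : f i j ≠ g i j := fun e => by
  have hFG : span K {F} = span K {G} :=
    (hF.frame.a_pt.symm.trans (congrArg Projectivization.submodule e)).trans hF.g_a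
  obtain ⟨r, -, hr⟩ := exists_smul_of_span_singleton_eq hFG
  exact one_ne_zero (hF.frame.coeff_eq_zero (x := 1) (y := -r) (z := 0) (w := 0)
    (by linear_combination (norm := module) hr)).1

theorem h_ne_k (hF : CycleFrame f h g k i j F G H N l m) : h i j ≠ k i j := fun e => by
  have hHN : span K {H} = span K {N} :=
    (hF.h_eq.symm.trans (congrArg Projectivization.submodule e)).trans hF.k_eq
  obtain ⟨r, -, hr⟩ := exists_smul_of_span_singleton_eq hHN
  exact one_ne_zero (hF.frame.coeff_eq_zero (x := 0) (y := 0) (z := 1) (w := -r)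
    (by linear_combination (norm := module) hr)).2.2.1

end CycleFrame

namespace HasCycleFrames

theorem swap (hF : HasCycleFrames f h g k) :
    HasCycleFrames (Function.swap f) (Function.swap k) (Function.swap g) (Function.swap h) :=
  fun i j => by
    obtain ⟨F, G, H, N, l, m, hF⟩ := hF j i
    exact ⟨F, G, N, H, m, l, hF.swap⟩

theorem isLaplace1 (hF : HasCycleFrames f h g k) : IsLaplace1 f h := fun i j => by
  obtain ⟨F, G, H, N, l, m, hF⟩ := hF i j
  exact hF.h_eq.trans hF.frame.span_H_eq

theorem isLaplace2 (hF : HasCycleFrames f h g k) : IsLaplace2 f k := hF.swap.isLaplace1.swap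

theorem join2_h_horizontal (hF : HasCycleFrames f h g k) (hh : IsRegular h) (i j : ℤ) :
    join2 (h i j) (h (i + 1) j) = join2 (g (i + 1) j) (g (i + 1) (j + 1)) := by
  obtain ⟨F, G, H, N, l, m, hleft⟩ := hF i j
  obtain ⟨F', G', H', N', l', m', hright⟩ := hF (i + 1) j
  exact eq_join2 (finrank_join2_le _ _) (hh.ne_horizontal i j) hleft.h_le_join2_g_right
    hright.h_le_join2_g_left

theorem face_h (hF : HasCycleFrames f h g k) (hh : IsRegular h) (i j : ℤ) :
    face h i j = osc2 g (i + 1) (j + 1) := by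
  rw [face, hF.join2_h_horizontal hh, hF.join2_h_horizontal hh, osc2, join3, add_sub_cancel_right,
    join2, join2, ← sup_assoc, sup_assoc (g (i + 1) j).submodule, sup_idem]

theorem face_h_sub_one (hF : HasCycleFrames f h g k) (hh : IsRegular h) (i j : ℤ) :
    face h (i - 1) (j - 1) = osc2 g i j := by
  rw [hF.face_h hh, sub_add_cancel, sub_add_cancel]

theorem isConjugate_h (hF : HasCycleFrames f h g k) (hh : IsRegular h) : IsConjugate h :=
  fun i j => by
    rw [hF.face_h hh]
    exact finrank_join3_le _ _ _

theorem finrank_osc2_g (hF : HasCycleFrames f h g k) (hh : IsRegular h) (i j : ℤ) :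
    finrank K (osc2 g i j) = 3 :=
  le_antisymm (finrank_join3_le _ _ _)
    (hF.face_h_sub_one hh i j ▸ hh.not_collinear (i - 1) (j - 1))

theorem isLaplace1_h (hF : HasCycleFrames f h g k) (hh : IsRegular h) :
    IsLaplace1 h (fun i j => g (i + 1) (j + 1)) := fun i j => by
  refine Pt.eq_inf (isLine_join2 (hh.ne_horizontal _ _)) (isLine_join2 (hh.ne_horizontal _ _))
    (hh.join_ne i j) ?_ ?_
  · exact le_sup_right.trans (hF.join2_h_horizontal hh i j).ge
  · exact le_sup_left.trans (hF.join2_h_horizontal hh i (j + 1)).ge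

theorem h_le_osc1_f (hF : HasCycleFrames f h g k) (i j : ℤ) : (h i j).submodule ≤ osc1 f i j :=
  ((hF.isLaplace1 i j).trans_le inf_le_left).trans (sup_le_sup_right le_sup_right _)

theorem h_left_le_osc1_f (hF : HasCycleFrames f h g k) (i j : ℤ) :
    (h (i - 1) j).submodule ≤ osc1 f i j := by
  have hle := (hF.isLaplace1 (i - 1) j).trans_le inf_le_left
  rw [sub_add_cancel] at hle
  exact hle.trans le_sup_left

theorem h_below_le_join2_f (hF : HasCycleFrames f h g k) (i j : ℤ) :
    (h i (j - 1)).submodule ≤ join2 (f i j) (f (i + 1) j) := by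
  have hle := (hF.isLaplace1 i (j - 1)).trans_le inf_le_right
  rwa [sub_add_cancel] at hle

theorem osc2_g (hF : HasCycleFrames f h g k) (hf : IsRegular f) (hh : IsRegular h) (i j : ℤ) :
    osc2 g i j = osc1 f i j := by
  refine eq_of_le_of_finrank_eq ?_ ((hF.finrank_osc2_g hh i j).trans (hf.osc1_plane i j).symm)
  have hbelow : (h (i - 1) (j - 1)).submodule ≤ osc1 f i j := by
    have hle := hF.h_below_le_join2_f (i - 1) j
    rw [sub_add_cancel] at hle
    exact hle.trans le_sup_left
  rw [← hF.face_h_sub_one hh, face, sub_add_cancel, sub_add_cancel]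
  exact sup_le
    (sup_le hbelow ((hF.h_below_le_join2_f i j).trans (sup_le_sup_right le_sup_right _)))
    (sup_le (hF.h_left_le_osc1_f i j) (hF.h_le_osc1_f i j))

-- If the two planes agreed, they would contain the independent vectors `F`, `G`, `H`, `N`.
theorem osc_h_ne (hF : HasCycleFrames f h g k) (hh : IsRegular h) (i j : ℤ) :
    osc1 h i j ≠ osc2 h i j := fun e => by
  have hg_left : join2 (g i j) (g i (j + 1)) ≤ osc1 h i j := by
    have hjoin := hF.join2_h_horizontal hh (i - 1) j
    rw [sub_add_cancel] at hjoin
    exact hjoin.ge.trans le_sup_left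
  have hg_right : join2 (g (i + 1) j) (g (i + 1) (j + 1)) ≤ osc1 h i j :=
    (hF.join2_h_horizontal hh i j).ge.trans (sup_le_sup_right le_sup_right _)
  have hf_bottom : join2 (f i j) (f (i + 1) j) ≤ osc1 h i j := by
    have hne := hh.ne_vertical i (j - 1)
    rw [sub_add_cancel] at hne
    rw [← eq_join2 (finrank_join2_le _ _) hne (hF.h_below_le_join2_f i j)
      ((hF.isLaplace1 i j).trans_le inf_le_left), e]
    exact le_sup_left
  have hh_mid : (h i j).submodule ≤ osc1 h i j := le_sup_right.trans le_sup_left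
  obtain ⟨F, G, H, N, l, m, hF⟩ := hF i j
  have hFmem : F ∈ osc1 h i j :=
    (span_singleton_le_iff_mem _ _).1 (hF.frame.a_pt.ge.trans (le_sup_left.trans hf_bottom))
  have hGmem : G ∈ osc1 h i j :=
    (span_singleton_le_iff_mem _ _).1 (hF.g_a.ge.trans (le_sup_left.trans hg_left))
  have hGNmem : G - m • N ∈ osc1 h i j :=
    (span_singleton_le_iff_mem _ _).1 (hF.g_b.ge.trans (le_sup_left.trans hg_right))
  have hHmem : H ∈ osc1 h i j := (span_singleton_le_iff_mem _ _).1 (hF.h_eq.ge.trans hh_mid)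
  have hNmem : N ∈ osc1 h i j := (smul_mem_iff _ hF.frame.m_ne).1 (by
    simpa using sub_mem hGmem hGNmem)
  exact notMem_of_finrank_le_three hF.frame.indep (hh.osc1_plane i j).le hFmem hGmem hHmem hNmem

theorem isLaplaceCycle (hF : HasCycleFrames f h g k) (hf : IsRegular f) (hh : IsRegular h)
    (hk : IsRegular k) : IsLaplaceCycle f h g k where
  f_conj i j := by
    obtain ⟨F, G, H, N, l, m, hF⟩ := hF i j
    exact hF.finrank_face_f_le
  h_conj := hF.isConjugate_h hh
  g_conj i j := by
    obtain ⟨F, G, H, N, l, m, hF⟩ := hF i j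
    exact hF.finrank_face_g_le
  k_conj := (hF.swap.isConjugate_h hk.swap).swap
  f_reg := hf
  h_reg := hh
  g_reg.osc1_plane i j := hF.swap.finrank_osc2_g hk.swap j i
  g_reg.osc2_plane := hF.finrank_osc2_g hh
  g_reg.not_collinear i j := by
    obtain ⟨F, G, H, N, l, m, hF⟩ := hF i j
    exact hF.two_lt_finrank_face_g
  k_reg := hk
  h_eq := hF.isLaplace1
  k_eq := hF.isLaplace2
  g_eq_first := hF.isLaplace1_h hh
  g_eq_second := (hF.swap.isLaplace1_h hk.swap).swap

theorem inGeneralPosition (hF : HasCycleFrames f h g k) (hf : IsRegular f) (hh : IsRegular h)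
    (hk : IsRegular k) (ho : ∀ i j, osc1 f i j ≠ osc2 f i j) : InGeneralPosition f h g k where
  f_ne_g i j := by
    obtain ⟨F, G, H, N, l, m, hF⟩ := hF i j
    exact hF.f_ne_g
  h_ne_k i j := by
    obtain ⟨F, G, H, N, l, m, hF⟩ := hF i j
    exact hF.h_ne_k
  osc_f := ho
  osc_h := hF.osc_h_ne hh
  osc_g i j := by
    have hg : osc1 g i j = osc2 f i j := hF.swap.osc2_g hf.swap hk.swap j i
    rw [hg, hF.osc2_g hf hh]
    exact (ho i j).symm
  osc_k i j := (hF.swap.osc_h_ne hk.swap j i).symm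
  skew i j := by
    obtain ⟨F, G, H, N, l, m, hF⟩ := hF i j
    exact ⟨hF.frame.skew_ab, hF.frame.skew_ac⟩

end HasCycleFrames

/-- The point of a net together with the line of a congruence at the same vertex; this is
`cycleFlag` for congruences not yet known to be diagonal. -/
abbrev netFlag (f : Net K) (A : Congruence K) (i j : ℤ) : Flag K := ((f i j).submodule, A i j)

section Corner

variable {b b' : Flag K} {F' G' H' N' : Fin 4 → K} {l' m' : K} {j' s s' i₁ i₂ j₁ j₂ : ℤ}

theorem corner_eq_of_le_osc1 (h : A i j' ≤ osc1 f i j') (hs : s = 1 ∨ s = -1)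
    (hs' : s' = 1 ∨ s' = -1)
    (hF : QuadFrame (netFlag f A i j) b (netFlag f A i j') (netFlag f A (i + s) j') F G H N l m)
    (hF' : QuadFrame (netFlag f A i j) b' (netFlag f A i j') (netFlag f A (i + s') j')
      F' G' H' N' l' m') : span K {G} = span K {G'} :=
  (hF.line_a_inf_eq (finrank_join3_le _ _ _) h (le_osc1 f i j' hs)).symm.trans
    (hF'.line_a_inf_eq (finrank_join3_le _ _ _) h (le_osc1 f i j' hs'))

theorem HasFrames.corner_eq (hfr : HasFrames (netFlag f A)) (h₁ : ∀ i j, A i j ≤ osc1 f i j)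
    (h₂ : ∀ i j, A i j ≤ osc2 f i j) (hi₁ : i₁ = i + 1 ∨ i₁ = i + -1)
    (hj₁ : j₁ = j + 1 ∨ j₁ = j + -1) (hi₂ : i₂ = i + 1 ∨ i₂ = i + -1)
    (hj₂ : j₂ = j + 1 ∨ j₂ = j + -1)
    (hF : QuadFrame (netFlag f A i j) (netFlag f A i₁ j) (netFlag f A i j₁) (netFlag f A i₁ j₁)
      F G H N l m)
    (hF' : QuadFrame (netFlag f A i j) (netFlag f A i₂ j) (netFlag f A i j₂) (netFlag f A i₂ j₂)
      F' G' H' N' l' m') : span K {G} = span K {G'} := by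
  obtain ⟨s, hs, rfl⟩ : ∃ s, (s = 1 ∨ s = -1) ∧ i₁ = i + s := ⟨i₁ - i, by omega, by omega⟩
  obtain ⟨t, ht, rfl⟩ : ∃ t, (t = 1 ∨ t = -1) ∧ j₁ = j + t := ⟨j₁ - j, by omega, by omega⟩
  obtain ⟨s', hs', rfl⟩ : ∃ s, (s = 1 ∨ s = -1) ∧ i₂ = i + s := ⟨i₂ - i, by omega, by omega⟩
  obtain ⟨t', ht', rfl⟩ : ∃ t, (t = 1 ∨ t = -1) ∧ j₂ = j + t := ⟨j₂ - j, by omega, by omega⟩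
  obtain ⟨F₁, G₁, H₁, N₁, l₁, m₁, hF₁⟩ := hfr.exists_quadFrame i j hs' ht
  exact (corner_eq_of_le_osc1 (h₁ i (j + t)) hs hs' hF hF₁).trans
    (corner_eq_of_le_osc1 (f := Function.swap f) (A := Function.swap A) (h₂ (i + s') j) ht ht'
      hF₁.swap hF'.swap)

end Corner

theorem HasFrames.exists_hasCycleFrames (hfr : HasFrames (netFlag f A))
    (h₁ : ∀ i j, A i j ≤ osc1 f i j) (h₂ : ∀ i j, A i j ≤ osc2 f i j) :
    ∃ h g k : Net K, diagonal f g = A ∧ HasCycleFrames f h g k := by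
  have exists_pt {v : Fin 4 → K} (hv : v ≠ 0) : ∃ x : Pt K, x.submodule = span K {v} :=
    ⟨.mk K v hv, Projectivization.submodule_mk v hv⟩
  choose F G H N l m hF using id hfr
  choose g hg using fun i j => exists_pt (hF i j).G_ne
  choose h hh using fun i j => exists_pt (hF i j).H_ne
  choose k hk using fun i j => exists_pt (hF i j).N_ne
  have hdiag : diagonal f g = A := funext fun i => funext fun j => by
    have hf : (f i j).submodule = span K {F i j} := (hF i j).a_pt
    have hA : A i j = span K {F i j, G i j} := (hF i j).a_line
    rw [diagonal, join2, hf, hg, hA, ← span_insert]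
  refine ⟨h, g, k, hdiag, fun i j => ⟨F i j, G i j, H i j, N i j, l i j, m i j,
    { frame := ?_, g_a := hg i j, g_b := ?_, g_c := ?_, g_d := ?_, h_eq := hh i j,
      k_eq := hk i j }⟩⟩
  · simp only [cycleFlag, hdiag]
    exact hF i j
  · exact (hg (i + 1) j).trans (hfr.corner_eq h₁ h₂ (by omega) (by omega) (by omega) (by omega)
      (hF (i + 1) j) (hF i j).flip_fst)
  · exact (hg i (j + 1)).trans (hfr.corner_eq h₁ h₂ (by omega) (by omega) (by omega) (by omega)
      (hF i (j + 1)) (hF i j).flip_snd)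
  · have hG : G i j - l i j • H i j - m i j • N i j
        = G i j - m i j • N i j - -l i j • -H i j := by module
    rw [hG]
    exact (hg (i + 1) (j + 1)).trans (hfr.corner_eq h₁ h₂ (by omega) (by omega) (by omega)
      (by omega) (hF (i + 1) (j + 1)) (hF i j).flip_fst.flip_snd)

theorem HasFrames.le_osc2 (hfr : HasFrames (netFlag f A)) (h₁ : ∀ i j, A i j ≤ osc1 f i j)
    (hcol₀ : ∀ j, A 0 j ≤ osc2 f 0 j) (hcol₁ : ∀ j, A 1 j ≤ osc2 f 1 j) (i j : ℤ) :
    A i j ≤ osc2 f i j := by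
  revert j
  refine outward_induction_of_zero_one (Q := fun i => ∀ j, A i j ≤ osc2 f i j) hcol₀ hcol₁ ?_ i
  intro i s hs hi hprev j
  rw [sub_eq_add_neg] at hprev
  replace hs := hs.eq_one_or_eq_neg_one
  have hs' : -s = 1 ∨ -s = -1 := by omega
  obtain ⟨_, G₁, _, _, _, _, hF₁⟩ := hfr.exists_quadFrame i j hs (t := 1) (.inl rfl)
  obtain ⟨_, G₂, _, _, _, _, hF₂⟩ := hfr.exists_quadFrame i j hs (t := -1) (.inr rfl)
  obtain ⟨_, G₃, _, _, _, _, hF₃⟩ := hfr.exists_quadFrame i j hs' (t := 1) (.inl rfl)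
  obtain ⟨_, G₄, _, _, _, _, hF₄⟩ := hfr.exists_quadFrame i j hs' (t := -1) (.inr rfl)
  have h₂₄ := corner_eq_of_le_osc1 (h₁ i (j + -1)) hs hs' hF₂ hF₄
  have h₃₁ := corner_eq_of_le_osc1 (h₁ i (j + 1)) hs' hs hF₃ hF₁
  have h₄₃ : span K {G₄} = span K {G₃} :=
    corner_eq_of_le_osc1 (f := Function.swap f) (A := Function.swap A) (i := j) (j' := i + -s)
      (hprev j) (.inr rfl) (.inl rfl) hF₄.swap hF₃.swap
  have hosc (i : ℤ) : osc2 f i j =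
      (f i (j + -1)).submodule ⊔ (f i j).submodule ⊔ (f i (j + 1)).submodule := by
    simp only [osc2, join3, sub_eq_add_neg]
  have hplane := hi j
  rw [hosc] at hplane ⊢
  have hle := hF₁.line_b_le hF₂ (h₂₄.trans (h₄₃.trans h₃₁)) hplane
  exact hle

end Existence

section SkewNets

variable {K : Type*} [Field K] {f : Net K} {A : Congruence K} {i j s t : ℤ}

theorem OppositeSkew.swap (hA : OppositeSkew A) : OppositeSkew (Function.swap A) := fun i j =>
  ⟨(hA j i).1, (hA j i).2.symm⟩

theorem IsRegular.not_join2_sup_join2_le (hf : IsRegular f) (i j : ℤ) (hs : s = 1 ∨ s = -1)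
    (ht : t = 1 ∨ t = -1) {L : Sub K} (hL : IsLine L) :
    ¬ join2 (f i j) (f (i + s) j) ⊔ join2 (f i (j + t)) (f (i + s) (j + t)) ≤ L := fun hle => by
  have right (i : ℤ) :
      2 < finrank K (join2 (f i j) (f (i + 1) j) ⊔ join2 (f i (j + t)) (f (i + 1) (j + t)) :
        Sub K) := by
    rcases ht with rfl | rfl
    · exact hf.not_collinear i j
    · have hface := hf.not_collinear i (j + -1)
      rwa [face, neg_add_cancel_right, sup_comm] at hface
  have hfour :
      2 < finrank K (join2 (f i j) (f (i + s) j) ⊔ join2 (f i (j + t)) (f (i + s) (j + t)) :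
        Sub K) := by
    rcases hs with rfl | rfl
    · exact right i
    · have hface := right (i + -1)
      rwa [neg_add_cancel_right, join2_comm, join2_comm (f (i + -1) (j + t))] at hface
  exact hfour.not_ge ((finrank_mono hle).trans_eq hL)

theorem IsRegular.line_le_osc1 (hf : IsRegular f) {A : Sub K} (hA : IsLine A)
    (hm : (f i j).submodule ≤ A) (hs : s = 1 ∨ s = -1)
    (h : (f (i + s) j).submodule ≤ (f (i - s) j).submodule ⊔ A) : A ≤ osc1 f i j := by
  have hle : osc1 f i j ≤ (f (i - s) j).submodule ⊔ A := by
    rcases hs with rfl | rfl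
    · exact sup_le (sup_le le_sup_left (hm.trans le_sup_right)) h
    · rw [sub_neg_eq_add] at h ⊢
      exact sup_le (sup_le h (hm.trans le_sup_right)) le_sup_left
  have hrank : finrank K ((f (i - s) j).submodule ⊔ A : Sub K) ≤ 3 :=
    finrank_sup_le_three (Projectivization.finrank_submodule _).le hA
  rw [eq_of_le_of_finrank_le hle (hrank.trans_eq (hf.osc1_plane i j).symm)]
  exact le_sup_right

/-- A regular net together with a congruence whose lines at the vertices of every elementary
quadrilateral are pairwise skew. -/
structure IsSkewNet (f : Net K) (A : Congruence K) : Prop where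
  regular : IsRegular f
  line : ∀ i j, IsLine (A i j)
  adjacent : AdjacentSkew A
  opposite : OppositeSkew A

namespace IsSkewNet

theorem swap (h : IsSkewNet f A) : IsSkewNet (Function.swap f) (Function.swap A) :=
  ⟨h.regular.swap, fun i j => h.line j i, h.adjacent.swap, h.opposite.swap⟩

theorem pairwiseSkewLines (h : IsSkewNet f A) (i j : ℤ) (hs : s = 1 ∨ s = -1)
    (ht : t = 1 ∨ t = -1) :
    PairwiseSkewLines (A i j) (A (i + s) j) (A i (j + t)) (A (i + s) (j + t)) where
  line_a := h.line _ _
  line_b := h.line _ _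
  line_c := h.line _ _
  line_d := h.line _ _
  skew_ab := h.adjacent.horizontal i j hs
  skew_ac := h.adjacent.vertical i j ht
  skew_ad := (h.opposite.diagonals i j hs ht).1
  skew_bc := (h.opposite.diagonals i j hs ht).2
  skew_bd := h.adjacent.vertical (i + s) j ht
  skew_cd := h.adjacent.horizontal i (j + t) hs

theorem exists_quadFrame_of_nextFlag (h : IsSkewNet f A) (hs : s = 1 ∨ s = -1)
    (ht : t = 1 ∨ t = -1) (ha : (f i j).submodule ≤ A i j)
    (hb : (f (i + s) j).submodule ≤ A (i + s) j) (hc : (f i (j + t)).submodule ≤ A i (j + t))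
    (hnext : nextFlag (netFlag f A i j) (netFlag f A (i + s) j) (netFlag f A i (j + t))
      (netFlag f A (i - s) (j + t)).1 = netFlag f A (i + s) (j + t)) :
    ∃ F G H N l m, QuadFrame (netFlag f A i j) (netFlag f A (i + s) j) (netFlag f A i (j + t))
      (netFlag f A (i + s) (j + t)) F G H N l m :=
  (h.pairwiseSkewLines i j hs ht).exists_quadFrame_of_nextFlag ha hb hc hnext fun _ hL =>
    h.regular.not_join2_sup_join2_le i j hs ht hL

theorem exists_quadFrame_of_osc (h : IsSkewNet f A) (ho : ∀ i j, osc1 f i j ≠ osc2 f i j)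
    (hm : ∀ i j, (f i j).submodule ≤ A i j) (h₁ : ∀ i j, A i j ≤ osc1 f i j)
    (hcol : ∀ j, A i j ≤ osc2 f i j) (hcol' : ∀ j, A (i + 1) j ≤ osc2 f (i + 1) j)
    (hreg : A (i + 1) (j + 1) ∈ regulus (A i j) (A (i + 1) j) (A i (j + 1)))
    (hπ : (f (i + 1) (j + 1)).submodule ≤ join3 (f i j) (f (i + 1) j) (f i (j + 1))) :
    ∃ F G H N l m, QuadFrame (netFlag f A i j) (netFlag f A (i + 1) j) (netFlag f A i (j + 1))
      (netFlag f A (i + 1) (j + 1)) F G H N l m := by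
  have not_le_both {i j : ℤ} (h₂ : A i j ≤ osc2 f i j) {p : Pt K} (hp : ¬ p.submodule ≤ A i j)
      (hp₁ : p.submodule ≤ osc1 f i j) : ¬ p.submodule ≤ osc2 f i j := fun hp₂ =>
    ho i j (plane_eq_of_line_le_of_point_le (h.line i j) hp (finrank_join3_le _ _ _)
      (finrank_join3_le _ _ _) (h₁ i j) h₂ hp₁ hp₂)
  have hleft (i j : ℤ) : (f i j).submodule ≤ osc1 f (i + 1) j := by
    rw [osc1, add_sub_cancel_right]
    exact le_sup_left.trans le_sup_left
  have hbelow (i j : ℤ) : (f i j).submodule ≤ osc2 f i (j + 1) := by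
    rw [osc2, add_sub_cancel_right]
    exact le_sup_left.trans le_sup_left
  have hmid (i j : ℤ) : (f i j).submodule ≤ osc2 f i j := le_sup_right.trans le_sup_left
  have hquad := h.pairwiseSkewLines i j (s := 1) (t := 1) (.inl rfl) (.inl rfl)
  refine hquad.exists_quadFrame hreg (hm _ _) (hm _ _) (hm _ _) (hm _ _) hπ (fun hbc => ?_)
    (fun hac => ?_) (fun hab => ?_)
    fun _ hL => h.regular.not_join2_sup_join2_le i j (.inl rfl) (.inl rfl) hL
  · refine not_le_both (hcol' (j + 1)) (Pt.not_le_of_skew hquad.skew_cd (hm _ _)) (hleft _ _) ?_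
    exact (Pt.exchange hbc (h.regular.ne_vertical (i + 1) j).symm).trans
      (sup_le (hbelow _ _) (hmid _ _))
  · exact not_le_both (hcol (j + 1)) (Pt.not_le_of_skew hquad.skew_cd.symm (hm _ _))
      le_sup_right (hac.trans (sup_le (hbelow _ _) (hmid _ _)))
  · exact not_le_both (hcol' j) (Pt.not_le_of_skew hquad.skew_bd.symm (hm _ _))
      (hab.trans (sup_le (hleft _ _) (le_sup_right.trans le_sup_left))) le_sup_right

end IsSkewNet

theorem exists_quadFrame_of_edges {a : ℤ → ℤ → Flag K} {i' i'' j' j'' : ℤ}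
    (hi : i' = i ∧ i'' = i + 1 ∨ i' = i + 1 ∧ i'' = i)
    (hj : j' = j ∧ j'' = j + 1 ∨ j' = j + 1 ∧ j'' = j)
    (h : ∃ F G H N l m, QuadFrame (a i' j') (a i'' j') (a i' j'') (a i'' j'') F G H N l m) :
    ∃ F G H N l m, QuadFrame (a i j) (a (i + 1) j) (a i (j + 1)) (a (i + 1) (j + 1))
      F G H N l m := by
  obtain ⟨F, G, H, N, l, m, hF⟩ := h
  rcases hi with ⟨rfl, rfl⟩ | ⟨rfl, rfl⟩ <;> rcases hj with ⟨rfl, rfl⟩ | ⟨rfl, rfl⟩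
  · exact ⟨_, _, _, _, _, _, hF⟩
  · exact ⟨_, _, _, _, _, _, hF.flip_snd⟩
  · exact ⟨_, _, _, _, _, _, hF.flip_fst⟩
  · exact ⟨_, _, _, _, _, _, hF.flip_fst.flip_snd⟩

end SkewNets

section ProjectedNets

variable {K : Type*} [Field K] {f : Net K} {A : Congruence K} {i j s t : ℤ}

/-- The values of a net and a congruence on the axes; this is `axisData` for congruences not yet
known to be diagonal. -/
def axisRestriction (f : Net K) (A : Congruence K) : AxisData K where
  fx i := f i 0
  fy i := f 0 i
  Ax i := A i 0
  Ay i := A 0 i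

/-- A net and a congruence that the construction reproduces without singularities from their values
on the axes and the point at `(1, 1)`. -/
structure IsProjectedNet (f : Net K) (A : Congruence K) : Prop extends IsSkewNet f A where
  osc_ne : ∀ i j, osc1 f i j ≠ osc2 f i j
  suitable : (axisRestriction f A).IsSuitable
  mem_conic : f 1 1 ∈ (axisRestriction f A).conic
  construct_eq : ∀ i j, (axisRestriction f A).construct (f 1 1) i j = netFlag f A i j

namespace IsProjectedNet

theorem horizontal (h : IsProjectedNet f A) (hs : Outward 1 i s) (ht : Outward 0 j t) :
    nextFlag (netFlag f A i j) (netFlag f A (i + s) j) (netFlag f A i (j + t))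
      (netFlag f A (i - s) (j + t)).1 = netFlag f A (i + s) (j + t) := by
  simpa only [h.construct_eq] using construct_horizontal (axisRestriction f A) (f 1 1) hs ht

theorem vertical (h : IsProjectedNet f A) (ht : Outward 1 j t) :
    nextFlag (netFlag f A 0 j) (netFlag f A 0 (j + t)) (netFlag f A 1 j)
      (netFlag f A 1 (j - t)).1 = netFlag f A 1 (j + t) := by
  simpa only [h.construct_eq] using construct_vertical (axisRestriction f A) (f 1 1) rfl ht

theorem regulus_one_one (h : IsProjectedNet f A) :
    A 1 1 ∈ regulus (A 0 0) (A 1 0) (A 0 1) ∧ (f 1 1).submodule ≤ A 1 1 :=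
  regulusLine_spec (h.line 1 1) (congrArg Prod.snd
    ((construct_one_one (axisRestriction f A) (f 1 1)).symm.trans (h.construct_eq 1 1)))

theorem le_line (h : IsProjectedNet f A) (i j : ℤ) : (f i j).submodule ≤ A i j := by
  refine grid_induction (P := fun i j => (f i j).submodule ≤ A i j) h.suitable.mem_x
    h.suitable.mem_y h.regulus_one_one.2 ?_ ?_ i j
  · exact fun j t ht _ _ _ _ => (nextFlag_spec (h.line _ _) (h.vertical ht)).2.1
  · exact fun i j s t hs ht _ _ _ _ => (nextFlag_spec (h.line _ _) (h.horizontal hs ht)).2.1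

theorem le_osc1 (h : IsProjectedNet f A) (i j : ℤ) : A i j ≤ osc1 f i j := by
  obtain ⟨s, hs⟩ := exists_outward_one i
  rcases eq_or_ne j 0 with rfl | hj
  · exact h.suitable.osc_x i
  · obtain ⟨j', t, ht, rfl⟩ := exists_outward_zero_add_eq hj
    exact h.regular.line_le_osc1 (h.line _ _) (h.le_line _ _) hs.eq_one_or_eq_neg_one
      (nextFlag_spec (h.line _ _) (h.horizontal hs ht)).2.2.2

theorem column_zero_le_osc2 (h : IsProjectedNet f A) (j : ℤ) : A 0 j ≤ osc2 f 0 j :=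
  h.suitable.osc_y j

theorem column_one_le_osc2 (h : IsProjectedNet f A) (j : ℤ) : A 1 j ≤ osc2 f 1 j := by
  obtain ⟨t, ht⟩ := exists_outward_one j
  exact h.regular.swap.line_le_osc1 (h.line _ _) (h.le_line _ _) ht.eq_one_or_eq_neg_one
    (nextFlag_spec (h.line _ _) (h.vertical ht)).2.2.2

theorem hasFrames (h : IsProjectedNet f A) : HasFrames (netFlag f A) := fun i j => by
  rcases eq_or_ne i 0 with rfl | hi
  · rcases eq_or_ne j 0 with rfl | hj
    · exact h.exists_quadFrame_of_osc h.osc_ne h.le_line h.le_osc1 h.column_zero_le_osc2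
        h.column_one_le_osc2 h.regulus_one_one.1 h.mem_conic.2
    · obtain ⟨j', t, ht, hj'⟩ := exists_outward_edge (m := 1) (i := j) (by omega)
      obtain ⟨F, G, H, N, l, m, hF⟩ := h.swap.exists_quadFrame_of_nextFlag (i := j') (j := 0)
        (t := 1) ht.eq_one_or_eq_neg_one (.inl rfl) (h.le_line _ _) (h.le_line _ _) (h.le_line _ _)
        (h.vertical ht)
      exact exists_quadFrame_of_edges (.inl ⟨rfl, rfl⟩) hj' ⟨F, G, N, H, m, l, hF.swap⟩
  · obtain ⟨i', s, hs, hi'⟩ := exists_outward_edge (m := 1) (i := i) (by omega)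
    obtain ⟨j', t, ht, hj'⟩ := exists_outward_edge (m := 0) (i := j) (by omega)
    exact exists_quadFrame_of_edges hi' hj' (h.exists_quadFrame_of_nextFlag
      hs.eq_one_or_eq_neg_one ht.eq_one_or_eq_neg_one (h.le_line _ _) (h.le_line _ _)
      (h.le_line _ _) (h.horizontal hs ht))

theorem exists_cycle (h : IsProjectedNet f A) (hh : ∀ h, IsLaplace1 f h → IsRegular h)
    (hk : ∀ k, IsLaplace2 f k → IsRegular k) :
    ∃ h g k : Net K, diagonal f g = A ∧ IsLaplaceCycle f h g k ∧ InGeneralPosition f h g k := by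
  have hle := h.hasFrames.le_osc2 h.le_osc1 h.column_zero_le_osc2 h.column_one_le_osc2
  obtain ⟨h', g, k, hdiag, hF⟩ := h.hasFrames.exists_hasCycleFrames h.le_osc1 hle
  have hh' := hh h' hF.isLaplace1
  have hk' := hk k hF.isLaplace2
  exact ⟨h', g, k, hdiag, hF.isLaplaceCycle h.regular hh' hk',
    hF.inGeneralPosition h.regular hh' hk' h.osc_ne⟩

end IsProjectedNet

theorem axisRestriction_eq {d : AxisData K} {x : Pt K} (h0 : d.row0 0 = d.col0 0)
    (hfA : ∀ i j, d.construct x i j = netFlag f A i j) : axisRestriction f A = d := by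
  have hrow (i : ℤ) : netFlag f A i 0 = d.row0 i :=
    (hfA i 0).symm.trans (construct_zero_right d x i)
  have hcol (j : ℤ) : netFlag f A 0 j = d.col0 j :=
    (hfA 0 j).symm.trans (construct_zero_left d x h0 j)
  ext1
  · exact funext fun i => Projectivization.submodule_injective (congrArg Prod.fst (hrow i))
  · exact funext fun j => Projectivization.submodule_injective (congrArg Prod.fst (hcol j))
  · exact funext fun i => congrArg Prod.snd (hrow i)
  · exact funext fun j => congrArg Prod.snd (hcol j)

theorem AxisData.ConstructionRegular.exists_cycle {d : AxisData K} {x : Pt K}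
    (hc : d.ConstructionRegular x) (hd : d.IsSuitable) (hx : x ∈ d.conic) :
    ∃ f h g k : Net K, IsLaplaceCycle f h g k ∧ InGeneralPosition f h g k ∧
      OppositeSkew (diagonal f g) ∧ axisData f g = d ∧ f 1 1 = x := by
  obtain ⟨f, A, hfA, hline, hadj, hopp, hreg, hosc, hh, hk⟩ := hc
  obtain rfl : f 1 1 = x := Projectivization.submodule_injective
    (congrArg Prod.fst ((hfA 1 1).symm.trans (construct_one_one d x)))
  obtain rfl : axisRestriction f A = d := axisRestriction_eq
    (Prod.ext (congrArg Projectivization.submodule hd.f_origin) hd.A_origin) hfA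
  have hnet : IsProjectedNet f A := ⟨⟨hreg, hline, hadj, hopp⟩, hosc, hd, hx, hfA⟩
  obtain ⟨h, g, k, rfl, hcycle, hpos⟩ := hnet.exists_cycle hh hk
  exact ⟨f, h, g, k, hcycle, hpos, hopp, rfl, rfl⟩

end ProjectedNets

theorem theorem22_general {K : Type*} [Field K] :
    (∀ f h g k : Net K, IsLaplaceCycle f h g k → InGeneralPosition f h g k →
      (axisData f g).IsSuitable ∧
      (Skew (diagonal f g 1 0) (diagonal f g 0 1) → f 1 1 ∈ (axisData f g).conic)) ∧
    (∀ f h g k f' h' g' k' : Net K,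
      IsLaplaceCycle f h g k → InGeneralPosition f h g k →
      IsLaplaceCycle f' h' g' k' → InGeneralPosition f' h' g' k' →
      axisData f g = axisData f' g' → f 1 1 = f' 1 1 →
      f = f' ∧ h = h' ∧ g = g' ∧ k = k') ∧
    (∀ d : AxisData K, d.IsSuitable → ∀ x ∈ d.conic,
      ((∃ f h g k : Net K, IsLaplaceCycle f h g k ∧ InGeneralPosition f h g k ∧
          OppositeSkew (diagonal f g) ∧ axisData f g = d ∧ f 1 1 = x) ↔
        d.ConstructionRegular x)) ∧
    (∀ f h g k : Net K, IsLaplaceCycle f h g k → InGeneralPosition f h g k →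
      OppositeSkew (diagonal f g) →
      ∀ i j s t : ℤ, (s = 1 ∨ s = -1) → (t = 1 ∨ t = -1) →
        nextFlag (cycleFlag f g i j) (cycleFlag f g (i + s) j) (cycleFlag f g i (j + t))
            (cycleFlag f g (i - s) (j + t)).1
          = cycleFlag f g (i + s) (j + t) ∧
        nextFlag (cycleFlag f g i j) (cycleFlag f g i (j + t)) (cycleFlag f g (i + s) j)
            (cycleFlag f g (i + s) (j - t)).1
          = cycleFlag f g (i + s) (j + t)) := by
  refine ⟨fun f h g k hc hp => ⟨hc.isSuitable hp, hc.mem_conic hp⟩,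
    fun f h g k f' h' g' k' hc hp hc' hp' => hc.unique hp hc' hp',
    fun d hd x hx => ⟨?_, fun hreg => hreg.exists_cycle hd hx⟩,
    fun f h g k hc hp ho i j s t => hc.nextFlag_eq hp ho i j⟩
  rintro ⟨f, h, g, k, hc, hp, ho, rfl, rfl⟩
  exact hc.constructionRegular hp ho

end LaplaceCycles

open LaplaceCycles in
theorem theorem22 {K : Type*} [Field K] (hK : ringChar K ≠ 2) :
    -- the values of a cycle on the axes are in suitable position, and `f 1 1` is on the conic
    (∀ f h g k : Net K, IsLaplaceCycle f h g k → InGeneralPosition f h g k →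
      (axisData f g).IsSuitable ∧
      (Skew (diagonal f g 1 0) (diagonal f g 0 1) → f 1 1 ∈ (axisData f g).conic)) ∧
    -- uniqueness
    (∀ f h g k f' h' g' k' : Net K,
      IsLaplaceCycle f h g k → InGeneralPosition f h g k →
      IsLaplaceCycle f' h' g' k' → InGeneralPosition f' h' g' k' →
      axisData f g = axisData f' g' → f 1 1 = f' 1 1 →
      f = f' ∧ h = h' ∧ g = g' ∧ k = k') ∧
    -- existence, whenever the construction meets no singularity, and only then
    (∀ d : AxisData K, d.IsSuitable → Skew (d.Ax 1) (d.Ay 1) → ∀ x ∈ d.conic,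
      ((∃ f h g k : Net K, IsLaplaceCycle f h g k ∧ InGeneralPosition f h g k ∧
          OppositeSkew (diagonal f g) ∧ axisData f g = d ∧ f 1 1 = x) ↔
        d.ConstructionRegular x)) ∧
    -- the projections agree on all routes through the net
    (∀ f h g k : Net K, IsLaplaceCycle f h g k → InGeneralPosition f h g k →
      OppositeSkew (diagonal f g) →
      ∀ i j s t : ℤ, (s = 1 ∨ s = -1) → (t = 1 ∨ t = -1) →
        nextFlag (cycleFlag f g i j) (cycleFlag f g (i + s) j) (cycleFlag f g i (j + t))
            (cycleFlag f g (i - s) (j + t)).1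
          = cycleFlag f g (i + s) (j + t) ∧
        nextFlag (cycleFlag f g i j) (cycleFlag f g i (j + t)) (cycleFlag f g (i + s) j)
            (cycleFlag f g (i + s) (j - t)).1
          = cycleFlag f g (i + s) (j + t)) := by
  obtain ⟨haxes, hunique, hexists, hproj⟩ := theorem22_general (K := K)
  exact ⟨haxes, hunique, fun d hd _ => hexists d hd, hproj⟩
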